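/- An arithmetic formula in the variables $x_1,\dots,x_n$ is a tree whose terminals are variables, whose $+$ gates have arbitrary nonzero fan-in and whose $\times$ gates have fan-in two; its size $s$ is the number of its nodes. The formula represents the polynomial $F(x_1,\dots,x_n)$ that is obtained by multiplying it out. A monomial belongs to the sum-product expansion of $F$ if it occurs when the formula is multiplied out, i.e. if its coefficient in $F\in\mathbb{N}[x_1,\dots,x_n]$ is not zero; the degree of $F$ is the largest degree of a monomial of the expansion. For a prime $p$, a monomial is a $p$-monomial if every variable that occurs in it has an exponent smaller than $p$. Theorem. There is a deterministic algorithm that, given a prime $p$ and an arithmetic formula of size $s$ representing an $n$-variate polynomial $F$ of degree $k$, decides whether $F$ has a $p$-monomial of degree $k$ in its sum-product expansion, and that runs in time $O^*(6.4^k+p^k)$. More precisely, there is a constant $c$, independent of $p$, $n$, $k$ and the formula, such that the running time is at most $c\,(6.4^k+p^k)\,(n+k+s)^c$. Here time is the running time of a random access machine under the logarithmic cost criterion, and the input is given as $p$, $n$ and the formula in prefix notation. -/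

import Mathlib

/-! ## Arithmetic formulas and the polynomials they represent -/

/-- Arithmetic formulas in the variables `x_0, …, x_{n-1}`: trees whose terminals are variables,
whose `+` gates have arbitrary (nonzero) fan-in and whose `×` gates have fan-in two. -/
inductive ArithFormula (n : ℕ) : Type
  | var (i : Fin n) : ArithFormula n
  | sum (m : ℕ) (C : Fin (m + 1) → ArithFormula n) : ArithFormula n
  | mul (C D : ArithFormula n) : ArithFormula n

namespace ArithFormula

/-- The number of nodes of the tree, terminals included. -/
def size {n : ℕ} : ArithFormula n → ℕ
  | var _ => 1
  | sum _ C => 1 + ∑ j, (C j).size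
  | mul C D => 1 + C.size + D.size

/-- The polynomial represented by a formula, that is, its sum-product expansion. The coefficients
are natural numbers: the coefficient of a monomial is the number of times that the monomial occurs
when the formula is multiplied out, so the support is the set of all monomials that occur. -/
noncomputable def toPoly {n : ℕ} : ArithFormula n → MvPolynomial (Fin n) ℕ
  | var i => MvPolynomial.X i
  | sum _ C => ∑ j, (C j).toPoly
  | mul C D => C.toPoly * D.toPoly

/-- A formula written in prefix notation as a list of natural numbers: `0, i` for the variable
`x_i`; `1, r` followed by the `r` operands for a `+` gate of fan-in `r`; `2` followed by the two
operands for a `×` gate. -/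
def encode {n : ℕ} : ArithFormula n → List ℕ
  | var i => [0, i]
  | sum m C => 1 :: (m + 1) :: (List.ofFn fun j => (C j).encode).flatten
  | mul C D => 2 :: (C.encode ++ D.encode)

end ArithFormula

/-- A monomial, given by its exponents, is a `c`-monomial if each of the variables that occur in it
has an exponent smaller than `c`. -/
def IsCMonomial {n : ℕ} (c : ℕ) (m : Fin n →₀ ℕ) : Prop :=
  ∀ i ∈ m.support, m i < c

/-- The polynomial `F` has a `c`-monomial of degree `k` in its sum-product expansion. -/
def HasCMonomial {n : ℕ} (c k : ℕ) (F : MvPolynomial (Fin n) ℕ) : Prop :=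
  ∃ m ∈ F.support, IsCMonomial c m ∧ m.degree = k

/-! ## Deterministic random access machines with logarithmic cost

A program works on finitely many arrays (numbered `0, 1, 2, …`) of natural numbers with indirect
addressing; entry `0` of an array serves as an ordinary register. Every access to an array entry is
charged the bit lengths of the address and of the value, every arithmetic operation the bit lengths
of its operands (the logarithmic cost criterion). -/

namespace RAM

/-- The content of the memory: `σ a i` is entry `i` of array `a`. -/
abbrev State : Type := ℕ → ℕ → ℕ

/-- The cost of handling the number `x`: its bit length plus one. -/
def len (x : ℕ) : ℕ := Nat.size x + 1

/-- The arithmetic operations (truncated subtraction, division with rounding down and `x / 0 = 0`).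
-/
inductive Op : Type
  | add | sub | mul | div

def Op.eval : Op → ℕ → ℕ → ℕ
  | .add, x, y => x + y
  | .sub, x, y => x - y
  | .mul, x, y => x * y
  | .div, x, y => x / y

/-- Expressions: constants, array entries, arithmetic operations. -/
inductive Expr : Type
  | const (c : ℕ) : Expr
  | get (a : ℕ) (i : Expr) : Expr
  | op (o : Op) (e f : Expr) : Expr

/-- The value of an expression. -/
def Expr.eval (σ : State) : Expr → ℕ
  | .const c => c
  | .get a i => σ a (i.eval σ)
  | .op o e f => o.eval (e.eval σ) (f.eval σ)

/-- The cost of evaluating an expression. -/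
def Expr.cost (σ : State) : Expr → ℕ
  | .const c => len c
  | .get a i => i.cost σ + len (i.eval σ) + len (σ a (i.eval σ))
  | .op _ e f => e.cost σ + f.cost σ + len (e.eval σ) + len (f.eval σ)

/-- Programs. A test counts as true if its value is not zero. -/
inductive Prog : Type
  | skip : Prog
  | set (a : ℕ) (i e : Expr) : Prog
  | seq (P Q : Prog) : Prog
  | cond (e : Expr) (P Q : Prog) : Prog
  | loop (e : Expr) (P : Prog) : Prog

/-- Entry `i` of array `a` is overwritten by `x`. -/
def write (σ : State) (a i x : ℕ) : State :=
  fun b j => if b = a ∧ j = i then x else σ b j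

/-- `Exec P σ t σ'`: the program `P`, started on the memory `σ`, halts with the memory `σ'`, and
this takes time `t`. -/
inductive Exec : Prog → State → ℕ → State → Prop
  | skip (σ : State) : Exec .skip σ 1 σ
  | set (a : ℕ) (i e : Expr) (σ : State) :
      Exec (.set a i e) σ (i.cost σ + e.cost σ + len (i.eval σ) + len (e.eval σ))
        (write σ a (i.eval σ) (e.eval σ))
  | seq {P Q : Prog} {σ₁ σ₂ σ₃ : State} {s t : ℕ} :
      Exec P σ₁ s σ₂ → Exec Q σ₂ t σ₃ → Exec (.seq P Q) σ₁ (s + t) σ₃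
  | cond_true {e : Expr} {P Q : Prog} {σ σ' : State} {t : ℕ} :
      e.eval σ ≠ 0 → Exec P σ t σ' → Exec (.cond e P Q) σ (e.cost σ + t) σ'
  | cond_false {e : Expr} {P Q : Prog} {σ σ' : State} {t : ℕ} :
      e.eval σ = 0 → Exec Q σ t σ' → Exec (.cond e P Q) σ (e.cost σ + t) σ'
  | loop_true {e : Expr} {P : Prog} {σ₁ σ₂ σ₃ : State} {s t : ℕ} :
      e.eval σ₁ ≠ 0 → Exec P σ₁ s σ₂ → Exec (.loop e P) σ₂ t σ₃ →
        Exec (.loop e P) σ₁ (e.cost σ₁ + s + t) σ₃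
  | loop_false {e : Expr} {P : Prog} {σ : State} :
      e.eval σ = 0 → Exec (.loop e P) σ (e.cost σ) σ

/-- The machine is deterministic: the time and the final memory are determined by the program and
the initial memory. -/
theorem Exec.deterministic {P : Prog} {σ τ τ' : State} {s t : ℕ}
    (h : Exec P σ s τ) (h' : Exec P σ t τ') : s = t ∧ τ = τ' := by
  induction h generalizing t τ' with
  | skip σ => cases h'; exact ⟨rfl, rfl⟩
  | set a i e σ => cases h'; exact ⟨rfl, rfl⟩
  | seq _ _ ih₁ ih₂ =>
    cases h' with
    | seq k₁ k₂ =>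
      obtain ⟨rfl, rfl⟩ := ih₁ k₁
      obtain ⟨rfl, rfl⟩ := ih₂ k₂
      exact ⟨rfl, rfl⟩
  | cond_true he _ ih =>
    cases h' with
    | cond_true _ k => obtain ⟨rfl, rfl⟩ := ih k; exact ⟨rfl, rfl⟩
    | cond_false he' _ => exact absurd he' he
  | cond_false he _ ih =>
    cases h' with
    | cond_true he' _ => exact absurd he he'
    | cond_false _ k => obtain ⟨rfl, rfl⟩ := ih k; exact ⟨rfl, rfl⟩
  | loop_true he _ _ ih₁ ih₂ =>
    cases h' with
    | loop_true _ k₁ k₂ =>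
      obtain ⟨rfl, rfl⟩ := ih₁ k₁
      obtain ⟨rfl, rfl⟩ := ih₂ k₂
      exact ⟨rfl, rfl⟩
    | loop_false he' => exact absurd he' he
  | loop_false he =>
    cases h' with
    | loop_true he' _ _ => exact absurd he he'
    | loop_false _ => exact ⟨rfl, rfl⟩

/-- The initial memory on the input `w`: array `0` holds the length of `w` in entry `0` and the
`i`-th number of `w` in entry `i + 1`; everything else is `0`. -/
def init (w : List ℕ) : State
  | 0, 0 => w.length
  | 0, i + 1 => w.getD i 0
  | _ + 1, _ => 0

/-- The answer of the machine is read from entry `0` of array `1`: it is "yes" if this number is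
not zero, and "no" if it is zero. -/
def Accepts (σ : State) : Prop := σ 1 0 ≠ 0

end RAM

/-!
The algorithm turns the formula into an acyclic graph with one edge for each terminal, whose paths
from node `0` to node `1` spell the words that arise when the formula is multiplied out. Every
variable is replaced by a sum of `min (p - 1) k` letters, so that monomials with exponents smaller
than `p` become words without repeated letters. Along the paths, products of two equal minors of a
Vandermonde matrix are summed up, for all pairs of sets of columns; the full minors yield a sum of
squares, which is nonzero if and only if there is a word of length `k` without repeated letters.
There are `4 ^ k` pairs of sets of columns, and all numbers have polynomially many bits.
-/

set_option linter.unusedSimpArgs false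

/-! Let `k` be the degree and `q = min (p - 1) k`. Replacing `x_i` by a sum of `q` distinct letters
turns the question into whether some word of length `k` in the expansion has no repeated letter
(`hasCMonomial_iff`). With letters read as numbers, a word of length `k` has distinct letters iff
its Vandermonde determinant is nonzero (`minor_full_ne_zero_iff`).

Determinants of different words could cancel in a sum, so their squares are summed instead. Laplace
expansion makes prepending a letter a linear map on the vector of minors indexed by sets of columns.
On products of two minors, indexed by pairs of sets, it acts by `halfStep` applied twice
(`prod_halfStep_apply`). These maps are additive, so one evaluation of the formula sums over all
words at once (`flow_add`). The coordinate of the pair of full sets is a sum of squares of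
determinants, nonzero iff a suitable word exists (`flow_actVar_ne_zero_iff`).

The machine never sees the tree. It parses the prefix notation into edges of a series-parallel graph
(`PartialGraph`); the same edges evaluated with longest paths give `k`, and with vectors give the
answer. `Runs` combines correctness, time and a uniform bound `R` on bit lengths, and
`runs_monomialTest` assembles the program. The number of steps is `4 ^ k` times a polynomial. Taking
`R` linear in `p` costs only a factor `p`, and `4 ^ k * p` is absorbed by `6.4 ^ k + p ^ k`
(`four_pow_mul_le`). -/

namespace RAM

/-! ### Costs from bounds on the memory -/

/-- If all entries of the memory have at most `R` bits, the value of `e` has at most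
`e.bits * R` bits. -/
def Expr.bits : Expr → ℕ
  | .const c => c.size + 1
  | .get _ _ => 1
  | .op _ e f => e.bits + f.bits

/-- If all entries of the memory have at most `R` bits, evaluating `e` costs at most
`e.weight * R`. -/
def Expr.weight : Expr → ℕ
  | .const c => len c
  | .get _ i => i.weight + (i.bits + 1) + 2
  | .op _ e f => e.weight + f.weight + (e.bits + 1) + (f.bits + 1)

/-- A bound for the cost of a single step of a program, in units of the word length. -/
def Prog.weight : Prog → ℕ
  | .skip => 1
  | .set _ i e => i.weight + e.weight + (i.bits + 1) + (e.bits + 1)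
  | .seq P Q => P.weight + Q.weight
  | .cond e P Q => e.weight + P.weight + Q.weight
  | .loop e P => e.weight + P.weight

/-- The arrays that a program may write to. -/
def Prog.targets : Prog → List ℕ
  | .skip => []
  | .set a _ _ => [a]
  | .seq P Q => P.targets ++ Q.targets
  | .cond _ P Q => P.targets ++ Q.targets
  | .loop _ P => P.targets

/-- All entries of the memory have at most `R` bits. -/
def Bounded (R : ℕ) (σ : State) : Prop := 1 ≤ R ∧ ∀ a i, σ a i < 2 ^ R

lemma write_of_ne {σ : State} {a b i x : ℕ} (h : b ≠ a) : write σ a i x b = σ b := by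
  funext j; simp [write, h]

lemma write_self {σ : State} {a i x : ℕ} : write σ a i x a = Function.update (σ a) i x := by
  funext j; simp [write, Function.update_apply]

lemma Bounded.write {R : ℕ} {σ : State} (h : Bounded R σ) (a i : ℕ) {x : ℕ} (hx : x < 2 ^ R) :
    Bounded R (write σ a i x) := by
  refine ⟨h.1, fun b j => ?_⟩
  unfold RAM.write
  split_ifs
  · exact hx
  · exact h.2 b j

lemma len_le {x b R : ℕ} (hR : 1 ≤ R) (h : x < 2 ^ (b * R)) : len x ≤ (b + 1) * R := by
  have := Nat.size_le.2 h
  unfold len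
  nlinarith

lemma Expr.one_le_bits (e : Expr) : 1 ≤ e.bits := by
  induction e with
  | const c => simp [bits]
  | get a i => simp [bits]
  | op o e f h₁ h₂ => simp only [bits]; omega

/-- Both powers are at least two, so their product dominates their sum; truncated subtraction and
division stay below the first operand. One crude bound thus serves all four operations. -/
lemma Op.eval_lt {o : Op} {x y b c : ℕ} (hb : 1 ≤ b) (hc : 1 ≤ c) (hx : x < 2 ^ b)
    (hy : y < 2 ^ c) : o.eval x y < 2 ^ (b + c) := by
  have h₁ : 2 ^ 1 ≤ 2 ^ b := Nat.pow_le_pow_right (by norm_num) hb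
  have h₂ : 2 ^ 1 ≤ 2 ^ c := Nat.pow_le_pow_right (by norm_num) hc
  rw [pow_add]
  cases o with
  | add => simp only [eval]; nlinarith
  | sub =>
    simp only [eval]
    have : x - y ≤ x := Nat.sub_le _ _
    nlinarith
  | mul => exact Nat.mul_lt_mul'' hx hy
  | div =>
    simp only [eval]
    have : x / y ≤ x := Nat.div_le_self _ _
    nlinarith

lemma Expr.eval_lt {R : ℕ} {σ : State} (h : Bounded R σ) (e : Expr) :
    e.eval σ < 2 ^ (e.bits * R) := by
  induction e with
  | const c =>
    simp only [eval, bits]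
    refine (Nat.lt_size_self c).trans_le (Nat.pow_le_pow_right (by norm_num) ?_)
    nlinarith [h.1]
  | get a i => simpa [eval, bits] using h.2 a _
  | op o e f he hf =>
    simp only [eval, bits, add_mul]
    exact Op.eval_lt (Nat.mul_pos e.one_le_bits h.1) (Nat.mul_pos f.one_le_bits h.1) he hf

lemma Expr.cost_le {R : ℕ} {σ : State} (h : Bounded R σ) (e : Expr) :
    e.cost σ ≤ e.weight * R := by
  induction e with
  | const c =>
    simp only [cost, weight]
    nlinarith [h.1]
  | get a i hi =>
    have h₁ := len_le h.1 (i.eval_lt h)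
    have h₂ := len_le (b := 1) h.1 (by simpa using h.2 a (i.eval σ))
    simp only [cost, weight, add_mul] at *
    omega
  | op o e f he hf =>
    have h₁ := len_le h.1 (e.eval_lt h)
    have h₂ := len_le h.1 (f.eval_lt h)
    simp only [cost, weight, add_mul] at *
    omega

/-- An assignment changes a single array. Since every register is an array of its own, this
syntactic check carries all facts about untouched data through subprograms and loops. -/
lemma Exec.frame {P : Prog} {σ τ : State} {t : ℕ} (h : Exec P σ t τ) :
    ∀ a ∉ P.targets, τ a = σ a := by
  induction h with
  | skip σ => simp
  | set a i e σ =>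
    intro b hb
    exact write_of_ne (by simpa [Prog.targets] using hb)
  | seq _ _ h₁ h₂ =>
    intro a ha
    simp only [Prog.targets, List.mem_append, not_or] at ha
    rw [h₂ a ha.2, h₁ a ha.1]
  | cond_true _ _ ih =>
    intro a ha
    simp only [Prog.targets, List.mem_append, not_or] at ha
    exact ih a ha.1
  | cond_false _ _ ih =>
    intro a ha
    simp only [Prog.targets, List.mem_append, not_or] at ha
    exact ih a ha.2
  | loop_true _ _ _ h₁ h₂ =>
    intro a ha
    rw [h₂ a ha, h₁ a ha]
  | loop_false _ => simp

/-! ### Total correctness with running times -/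

/-- The program `P`, started on `σ`, halts within `T` steps on a memory that satisfies `Q`, provided
that a step is charged `P.weight` times the word length `R`; all numbers keep at most `R` bits. -/
def Runs (R : ℕ) (P : Prog) (σ : State) (T : ℕ) (Q : State → Prop) : Prop :=
  ∃ t τ, Exec P σ t τ ∧ t ≤ T * (P.weight * R) ∧ Bounded R τ ∧ Q τ

/-- Boundedness and the frame property come for free from the execution, so postconditions need not
repeat them. -/
lemma Runs.mono {R : ℕ} {P : Prog} {σ : State} {T T' : ℕ} {Q Q' : State → Prop}
    (h : Runs R P σ T Q) (hT : T ≤ T')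
    (hQ : ∀ τ, Bounded R τ → (∀ a ∉ P.targets, τ a = σ a) → Q τ → Q' τ) : Runs R P σ T' Q' := by
  obtain ⟨t, τ, h₁, h₂, h₃, h₄⟩ := h
  exact ⟨t, τ, h₁, h₂.trans (Nat.mul_le_mul_right _ hT), h₃, hQ τ h₃ h₁.frame h₄⟩

lemma Runs.set {R : ℕ} {σ : State} (h : Bounded R σ) {a : ℕ} {i e : Expr} {Q : State → Prop}
    (he : e.eval σ < 2 ^ R) (hQ : Q (write σ a (i.eval σ) (e.eval σ))) :
    Runs R (.set a i e) σ 1 Q := by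
  refine ⟨_, _, .set a i e σ, ?_, h.write _ _ he, hQ⟩
  have h₁ := i.cost_le h
  have h₂ := e.cost_le h
  have h₃ := len_le h.1 (i.eval_lt h)
  have h₄ := len_le h.1 (e.eval_lt h)
  simp only [Prog.weight, add_mul] at *
  omega

lemma Runs.seq {R : ℕ} {P P' : Prog} {σ : State} {T T' : ℕ} {Q Q' : State → Prop}
    (h : Runs R P σ T Q)
    (h' : ∀ τ, Bounded R τ → (∀ a ∉ P.targets, τ a = σ a) → Q τ → Runs R P' τ T' Q') :
    Runs R (.seq P P') σ (T + T') Q' := by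
  obtain ⟨t, τ, h₁, h₂, h₃, h₄⟩ := h
  obtain ⟨t', τ', h₁', h₂', h₃', h₄'⟩ := h' τ h₃ h₁.frame h₄
  refine ⟨_, _, .seq h₁ h₁', ?_, h₃', h₄'⟩
  refine (Nat.add_le_add h₂ h₂').trans ?_
  simp only [Prog.weight, add_mul, mul_add]
  omega

lemma Runs.set_seq {R : ℕ} {σ : State} (h : Bounded R σ) {a : ℕ} {i e : Expr} {P : Prog} {T : ℕ}
    {Q : State → Prop} (he : e.eval σ < 2 ^ R)
    (hP : Bounded R (write σ a (i.eval σ) (e.eval σ)) →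
      Runs R P (write σ a (i.eval σ) (e.eval σ)) T Q) :
    Runs R (.seq (.set a i e) P) σ (1 + T) Q :=
  .seq (.set h he (Q := fun τ => τ = write σ a (i.eval σ) (e.eval σ)) rfl)
    fun _ hτ _ h' => by subst h'; exact hP hτ

lemma Runs.get_seq {R : ℕ} {σ : State} (h : Bounded R σ) {a b : ℕ} {i j : Expr} {P : Prog} {T : ℕ}
    {Q : State → Prop}
    (hP : Bounded R (write σ a (i.eval σ) (σ b (j.eval σ))) →
      Runs R P (write σ a (i.eval σ) (σ b (j.eval σ))) T Q) :
    Runs R (.seq (.set a i (.get b j)) P) σ (1 + T) Q :=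
  .set_seq h (h.2 _ _) hP

lemma Runs.cond {R : ℕ} {σ : State} (h : Bounded R σ) {e : Expr} {P P' : Prog} {T : ℕ}
    {Q : State → Prop} (h₁ : e.eval σ ≠ 0 → Runs R P σ T Q) (h₂ : e.eval σ = 0 → Runs R P' σ T Q) :
    Runs R (.cond e P P') σ (1 + T) Q := by
  have he := e.cost_le h
  by_cases h0 : e.eval σ = 0
  · obtain ⟨t, τ, k₁, k₂, k₃, k₄⟩ := h₂ h0
    refine ⟨_, _, .cond_false h0 k₁, ?_, k₃, k₄⟩
    simp only [Prog.weight, add_mul, mul_add] at *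
    omega
  · obtain ⟨t, τ, k₁, k₂, k₃, k₄⟩ := h₁ h0
    refine ⟨_, _, .cond_true h0 k₁, ?_, k₃, k₄⟩
    simp only [Prog.weight, add_mul, mul_add] at *
    omega

/-- Loops: `I m` holds when there are `m` more rounds to go. -/
lemma Runs.loop {R : ℕ} {e : Expr} {P : Prog} {T : ℕ} (I : ℕ → State → Prop)
    (h0 : ∀ σ, I 0 σ → e.eval σ = 0)
    (hs : ∀ m σ, Bounded R σ → I (m + 1) σ → e.eval σ ≠ 0 ∧ Runs R P σ T (I m)) :
    ∀ m σ, Bounded R σ → I m σ → Runs R (.loop e P) σ (m * (1 + T) + 1) (I 0)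
  | 0, σ, hσ, hI => by
    refine ⟨_, _, .loop_false (h0 σ hI), ?_, hσ, hI⟩
    have := e.cost_le hσ
    simp only [Prog.weight, add_mul, mul_add] at *
    omega
  | m + 1, σ, hσ, hI => by
    obtain ⟨k₀, t, τ, k₁, k₂, k₃, k₄⟩ := hs m σ hσ hI
    obtain ⟨t', τ', k₁', k₂', k₃', k₄'⟩ := Runs.loop I h0 hs m τ k₃ k₄
    refine ⟨_, _, .loop_true k₀ k₁ k₁', ?_, k₃', k₄'⟩
    have := e.cost_le hσ
    simp only [Prog.weight] at *
    have h₂ : T * (P.weight * R) ≤ T * ((e.weight + P.weight) * R) := by gcongr; omega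
    have h₃ : e.weight * R ≤ (e.weight + P.weight) * R := by gcongr; omega
    calc _ ≤ (e.weight + P.weight) * R + T * ((e.weight + P.weight) * R)
          + (m * (1 + T) + 1) * ((e.weight + P.weight) * R) := by omega
      _ = _ := by ring

/-! ### Counting loops -/

/-- Entry `0` of array `r`. -/
abbrev reg (r : ℕ) : Expr := .get r (.const 0)

/-- Assignment to entry `0` of array `r`. -/
abbrev Prog.let (r : ℕ) (e : Expr) : Prog := .set r (.const 0) e

/-- The program `P` is carried out for `r = 0, 1, …, b - 1`, where `b` is read from a register. -/
def forUpTo (r b : ℕ) (P : Prog) : Prog :=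
  .seq (.let r (.const 0))
    (.loop (.op .sub (reg b) (reg r)) (.seq P (.let r (.op .add (reg r) (.const 1)))))

/-- The invariant is required after the counter has been raised, and arrays outside the body keep
their contents from the start of the loop. Hence `I` has to mention only what the body changes. -/
lemma Runs.forUpTo {R : ℕ} {r b n T : ℕ} {P : Prog} {σ : State} (hσ : Bounded R σ)
    (hr : r ∉ P.targets) (hb : b ∉ P.targets) (hrb : b ≠ r) (hn : σ b 0 = n)
    (I : ℕ → State → Prop) (h0 : I 0 (write σ r 0 0))
    (hI : ∀ i τ, i < n → Bounded R τ → τ r 0 = i →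
      (∀ a, a ≠ r → a ∉ P.targets → τ a = σ a) → I i τ →
      Runs R P τ T fun τ' => I (i + 1) (write τ' r 0 (i + 1))) :
    Runs R (forUpTo r b P) σ (n * (T + 2) + 2) (I n) := by
  have hnR : n < 2 ^ R := hn ▸ hσ.2 b 0
  refine ((Runs.set_seq (T := n * (1 + (T + 1)) + 1) hσ (by simp [Expr.eval])
    fun h => ?_).mono (T' := n * (T + 2) + 2) (Q := I n) (le_of_eq (by ring)) fun _ _ _ h => h)
  -- `Runs.loop` counts the rounds still to go, `I` those already done.
  let J : ℕ → State → Prop := fun m τ => m ≤ n ∧ I (n - m) τ ∧ τ r 0 = n - m ∧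
    ∀ a, a ≠ r → a ∉ P.targets → τ a = σ a
  refine (Runs.loop (T := T + 1) J ?_ ?_ n _ h ?_).mono le_rfl fun τ _ _ hτ => by simpa using hτ.2.1
  · rintro τ ⟨-, -, h₁, h₂⟩
    simp [Expr.eval, Op.eval, h₁, h₂ b hrb hb, hn]
  · rintro m τ hτ ⟨hm, h₁, h₂, h₃⟩
    refine ⟨by simp only [Expr.eval, Op.eval, h₂, h₃ b hrb hb, hn]; omega, ?_⟩
    refine .seq (hI (n - (m + 1)) τ (by omega) hτ h₂ h₃ h₁) fun τ' hτ' hf hi => ?_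
    have e₁ : τ' r 0 = n - (m + 1) := by rw [hf r hr, h₂]
    refine .set hτ' ?_ ⟨by omega, ?_, ?_, ?_⟩
    · simp only [Expr.eval, Op.eval, e₁]; omega
    · simp only [Expr.eval, Op.eval, e₁]
      rw [show n - m = n - (m + 1) + 1 by omega]
      exact hi
    · simp only [Expr.eval, Op.eval, e₁, write_self]
      simp only [Function.update_self]
      omega
    · exact fun a ha ha' => by rw [write_of_ne ha, hf a ha', h₃ a ha ha']
  · refine ⟨le_rfl, ?_, ?_, ?_⟩
    · simpa [Expr.eval] using h0
    · simp [Expr.eval, write_self]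
    · exact fun a ha _ => write_of_ne ha

end RAM

/-! ### Minors of Vandermonde matrices, indexed by bit masks -/

/-- The number of ones among the `j` lowest binary digits of `x`. -/
def lowBits (x j : ℕ) : ℕ := ∑ i ∈ Finset.range j, x / 2 ^ i % 2

/-- Expansion along a row `1, t, t², …, t ^ (k - 1)`; sets of columns are written as bit masks. -/
def wedge (k t : ℕ) (f : ℕ → ℤ) (x : ℕ) : ℤ :=
  ∑ j ∈ Finset.range k, (x / 2 ^ j % 2 : ℕ) * (-1) ^ lowBits x j * (t : ℤ) ^ j * f (x - 2 ^ j)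

/-- The minor of the Vandermonde matrix of `w` with the columns given by a bit mask. -/
def minor (k : ℕ) : List ℕ → ℕ → ℤ
  | [] => fun x => if x = 0 then 1 else 0
  | t :: w => wedge k t (minor k w)

lemma mask_digit (S : Finset ℕ) (j : ℕ) :
    (∑ i ∈ S, 2 ^ i) / 2 ^ j % 2 = if j ∈ S then 1 else 0 := by
  have h : j ∈ S ↔ (∑ i ∈ S, 2 ^ i).testBit j = true := by
    conv_lhs => rw [← Finset.toFinset_bitIndices_sum_two_pow S]
    simp only [List.mem_toFinset, Nat.mem_bitIndices]
  rw [Nat.testBit_eq_decide_div_mod_eq, decide_eq_true_eq] at h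
  by_cases hj : j ∈ S
  · simp [hj, h.1 hj]
  · have h' := mt h.2 hj
    simp only [hj, if_false]
    omega

lemma lowBits_mask (S : Finset ℕ) (j : ℕ) :
    lowBits (∑ i ∈ S, 2 ^ i) j = (S.filter (· < j)).card := by
  simp only [lowBits, mask_digit, Finset.sum_ite_mem, Finset.sum_const, smul_eq_mul, mul_one]
  congr 1
  ext i
  simp [and_comm]

lemma mask_erase {S : Finset ℕ} {j : ℕ} (hj : j ∈ S) :
    ∑ i ∈ S, 2 ^ i - 2 ^ j = ∑ i ∈ S.erase j, 2 ^ i := by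
  rw [← Finset.add_sum_erase S _ hj, Nat.add_sub_cancel_left]

lemma mask_range (k : ℕ) : ∑ i ∈ Finset.range k, 2 ^ i = 2 ^ k - 1 := by
  rw [Nat.geomSum_eq le_rfl]
  simp

lemma wedge_mask (k t : ℕ) (f : ℕ → ℤ) {S : Finset ℕ} (hS : S ⊆ Finset.range k) :
    wedge k t f (∑ i ∈ S, 2 ^ i) =
      ∑ j ∈ S, (-1) ^ (S.filter (· < j)).card * (t : ℤ) ^ j * f (∑ i ∈ S.erase j, 2 ^ i) := by
  rw [wedge, ← Finset.sum_subset hS]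
  · refine Finset.sum_congr rfl fun j hj => ?_
    rw [mask_digit, lowBits_mask, mask_erase hj]
    simp [hj]
  · intro j _ hj
    rw [mask_digit]
    simp [hj]

/-- Each row of the expansion uses up one column, and the empty word admits only the empty mask. -/
lemma card_of_minor_ne_zero (k : ℕ) : ∀ (w : List ℕ) {S : Finset ℕ}, S ⊆ Finset.range k →
    minor k w (∑ i ∈ S, 2 ^ i) ≠ 0 → S.card = w.length
  | [], S, _, h => by
    simp only [minor, ne_eq, ite_eq_right_iff, one_ne_zero, imp_false, not_not,
      Finset.sum_eq_zero_iff] at h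
    simp only [List.length_nil, Finset.card_eq_zero]
    refine Finset.eq_empty_of_forall_notMem fun i hi => ?_
    simpa using h i hi
  | t :: w, S, hS, h => by
    rw [minor, wedge_mask k t _ hS] at h
    obtain ⟨j, hj, h⟩ := Finset.exists_ne_zero_of_sum_ne_zero h
    have := card_of_minor_ne_zero k w ((Finset.erase_subset j S).trans hS) (right_ne_zero_of_mul h)
    rw [Finset.card_erase_of_mem hj] at this
    have := Finset.card_pos.2 ⟨j, hj⟩
    simp only [List.length_cons]
    omega

/-- `φ` enumerates the columns in increasing order. The number of selected columns below `φ j` is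
`j`, so the sign in `wedge` is that of the Laplace expansion along the first row, and deleting
column `j` is composition with `succAbove`. -/
lemma minor_eq_det (k : ℕ) : ∀ (r : ℕ) (w : Fin r → ℕ) (φ : Fin r → ℕ), StrictMono φ →
    (∀ i, φ i < k) → minor k (List.ofFn w) (∑ i ∈ Finset.univ.image φ, 2 ^ i) =
      (Matrix.of fun i j => (w i : ℤ) ^ φ j).det
  | 0, w, φ, _, _ => by simp [minor]
  | r + 1, w, φ, hφ, hk => by
    have hS : Finset.univ.image φ ⊆ Finset.range k := by
      intro j
      simp only [Finset.mem_image, Finset.mem_univ, true_and, Finset.mem_range]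
      rintro ⟨i, rfl⟩
      exact hk i
    rw [List.ofFn_succ, minor, wedge_mask k _ _ hS, Finset.sum_image hφ.injective.injOn,
      Matrix.det_succ_row_zero]
    refine Finset.sum_congr rfl fun j _ => ?_
    have h₁ : ((Finset.univ.image φ).filter (· < φ j)).card = j := by
      rw [Finset.filter_image, Finset.card_image_of_injective _ hφ.injective]
      simp only [hφ.lt_iff_lt]
      exact (congrArg Finset.card (by ext; simp)).trans (Fin.card_Iio j)
    have h₂ : (Finset.univ.image φ).erase (φ j) = Finset.univ.image (φ ∘ j.succAbove) := by
      ext x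
      simp only [Finset.mem_erase, Finset.mem_image, Finset.mem_univ, true_and,
        Function.comp_apply]
      constructor
      · rintro ⟨hx, i, rfl⟩
        obtain ⟨i', hi⟩ := Fin.exists_succAbove_eq (x := i) (y := j) (fun h => hx (by rw [h]))
        exact ⟨i', by rw [hi]⟩
      · rintro ⟨i, rfl⟩
        exact ⟨fun h => Fin.succAbove_ne j i (hφ.injective h), _, rfl⟩
    rw [h₁, h₂, minor_eq_det k r (fun i => w i.succ) (φ ∘ j.succAbove)
      (hφ.comp (Fin.strictMono_succAbove j)) fun i => hk _]
    rfl

lemma minor_full_length (w : List ℕ) : minor w.length w (∑ i ∈ Finset.range w.length, 2 ^ i) =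
    (Matrix.vandermonde fun i => (w.get i : ℤ)).det := by
  have e : Finset.univ.image (fun i : Fin w.length => (i : ℕ)) = Finset.range w.length := by
    ext x
    simp only [Finset.mem_image, Finset.mem_univ, true_and, Finset.mem_range]
    exact ⟨fun ⟨i, hi⟩ => hi ▸ i.2, fun hx => ⟨⟨x, hx⟩, rfl⟩⟩
  have := minor_eq_det w.length w.length w.get (fun i => i) (fun _ _ h => h) (fun i => i.2)
  rw [List.ofFn_get, e] at this
  exact this

lemma minor_full_ne_zero_iff (k : ℕ) (w : List ℕ) :
    minor k w (2 ^ k - 1) ≠ 0 ↔ w.length = k ∧ w.Nodup := by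
  rw [← mask_range]
  constructor
  · intro h
    have hk := card_of_minor_ne_zero k w subset_rfl h
    rw [Finset.card_range] at hk
    subst hk
    refine ⟨rfl, ?_⟩
    rw [minor_full_length] at h
    rw [Matrix.det_vandermonde_ne_zero_iff] at h
    rw [List.nodup_iff_injective_get]
    exact fun i j hij => h (by simp only [hij])
  · rintro ⟨rfl, hw⟩
    rw [minor_full_length, Matrix.det_vandermonde_ne_zero_iff]
    exact fun i j hij => List.nodup_iff_injective_get.1 hw (Int.ofNat_inj.1 hij)

/-! ### Products of two minors -/

/-- Expansion of the first factor, followed by an exchange of the two factors. The vectors are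
indexed by pairs `(x, y)` of bit masks below `2 ^ k`, encoded as `x * 2 ^ k + y`. -/
def halfStep (k t : ℕ) : AddMonoid.End (ℕ → ℤ) where
  toFun f z := wedge k t (fun x => f (x * 2 ^ k + z / 2 ^ k)) (z % 2 ^ k)
  map_zero' := by funext z; simp [wedge]
  map_add' f g := by funext z; simp [wedge, mul_add, Finset.sum_add_distrib]

lemma halfStep_apply (k t : ℕ) (f : ℕ → ℤ) (z : ℕ) :
    halfStep k t f z = wedge k t (fun x => f (x * 2 ^ k + z / 2 ^ k)) (z % 2 ^ k) := rfl

/-- Only indices below `4 ^ k` are read, even where `x - 2 ^ j` is truncated, so a memory block of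
that length represents a vector. -/
lemma halfStep_congr {k t : ℕ} {f g : ℕ → ℤ} (h : ∀ z < 2 ^ k * 2 ^ k, f z = g z) {z : ℕ}
    (hz : z < 2 ^ k * 2 ^ k) : halfStep k t f z = halfStep k t g z := by
  rw [halfStep_apply, halfStep_apply, wedge, wedge]
  refine Finset.sum_congr rfl fun j _ => ?_
  rw [h]
  have h₁ : z / 2 ^ k < 2 ^ k := Nat.div_lt_of_lt_mul hz
  have h₂ : z % 2 ^ k < 2 ^ k := Nat.mod_lt _ (by positivity)
  have h₃ : z % 2 ^ k - 2 ^ j + 1 ≤ 2 ^ k :=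
    Nat.succ_le_of_lt ((Nat.sub_le _ _).trans_lt h₂)
  calc _ < (z % 2 ^ k - 2 ^ j) * 2 ^ k + 2 ^ k := by omega
    _ = (z % 2 ^ k - 2 ^ j + 1) * 2 ^ k := by ring
    _ ≤ _ := Nat.mul_le_mul_right _ h₃

/-- The factor that is not expanded is a constant in the expansion and moves to the front. A second
application therefore expands the other factor and restores the order. -/
lemma halfStep_mul {k t : ℕ} {f F G : ℕ → ℤ}
    (h : ∀ z < 2 ^ k * 2 ^ k, f z = F (z / 2 ^ k) * G (z % 2 ^ k)) {z : ℕ}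
    (hz : z < 2 ^ k * 2 ^ k) :
    halfStep k t f z = G (z / 2 ^ k) * wedge k t F (z % 2 ^ k) := by
  rw [halfStep_congr (g := fun z => F (z / 2 ^ k) * G (z % 2 ^ k)) h hz, halfStep_apply, wedge,
    wedge, Finset.mul_sum]
  refine Finset.sum_congr rfl fun j _ => ?_
  have h₁ : z / 2 ^ k < 2 ^ k := Nat.div_lt_of_lt_mul hz
  have e₁ : ((z % 2 ^ k - 2 ^ j) * 2 ^ k + z / 2 ^ k) / 2 ^ k = z % 2 ^ k - 2 ^ j := by
    rw [mul_comm, Nat.mul_add_div (by positivity), Nat.div_eq_of_lt h₁, add_zero]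
  have e₂ : ((z % 2 ^ k - 2 ^ j) * 2 ^ k + z / 2 ^ k) % 2 ^ k = z / 2 ^ k := by
    rw [mul_comm, Nat.mul_add_mod, Nat.mod_eq_of_lt h₁]
  simp only [e₁, e₂]
  ring

lemma prod_halfStep_apply (k : ℕ) : ∀ (w : List ℕ) {z : ℕ}, z < 2 ^ k * 2 ^ k →
    (w.map fun t => halfStep k t * halfStep k t).prod (fun z => if z = 0 then 1 else 0) z =
      minor k w (z / 2 ^ k) * minor k w (z % 2 ^ k)
  | [], z, hz => by
    simp only [List.map_nil, List.prod_nil, AddMonoid.End.coe_one, id_eq, minor]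
    have := Nat.div_add_mod z (2 ^ k)
    by_cases h : z = 0
    · simp [h]
    · have : ¬ (z / 2 ^ k = 0 ∧ z % 2 ^ k = 0) := by
        rintro ⟨h₁, h₂⟩
        rw [h₁, h₂] at this
        simp at this
        omega
      rw [if_neg h]
      by_cases h₁ : z / 2 ^ k = 0
      · rw [if_neg fun h₂ => this ⟨h₁, h₂⟩, mul_zero]
      · rw [if_neg h₁, zero_mul]
  | t :: w, z, hz => by
    simp only [List.map_cons, List.prod_cons, AddMonoid.End.coe_mul, Function.comp_apply]
    refine (halfStep_mul (F := minor k w) (G := minor k (t :: w)) (fun y hy => ?_) hz).trans ?_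
    · exact halfStep_mul (fun u hu => prod_halfStep_apply k w hu) hy
    · simp [minor]

/-! ### The words of a formula -/

namespace ArithFormula

variable {n : ℕ}

/-- The words that arise when a formula is multiplied out without commuting variables, the factors
of a product being taken in reverse order, after the variable `x_i` has been replaced by the sum of
the letters `i * q, …, i * q + q - 1`. -/
def words (q : ℕ) : ArithFormula n → List (List ℕ)
  | var i => (List.range q).map fun c => [i * q + c]
  | sum _ C => (List.ofFn fun j => (C j).words q).flatten
  | mul C D => (D.words q).flatMap fun v => (C.words q).map fun u => v ++ u

/-- The degree of the polynomial represented by a formula. -/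
def deg : ArithFormula n → ℕ
  | var _ => 1
  | sum _ C => Finset.univ.sup fun j => (C j).deg
  | mul C D => C.deg + D.deg

lemma mem_words_sum {q m : ℕ} {C : Fin (m + 1) → ArithFormula n} {w : List ℕ} :
    w ∈ (sum m C).words q ↔ ∃ j, w ∈ (C j).words q := by
  simp only [words, List.mem_flatten, List.mem_ofFn]
  exact ⟨fun ⟨_, ⟨j, h⟩, hw⟩ => ⟨j, h ▸ hw⟩, fun ⟨j, hw⟩ => ⟨_, ⟨j, rfl⟩, hw⟩⟩

lemma mem_words_mul {q : ℕ} {C D : ArithFormula n} {w : List ℕ} :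
    w ∈ (mul C D).words q ↔ ∃ v ∈ D.words q, ∃ u ∈ C.words q, v ++ u = w := by
  simp [words, List.mem_flatMap]

/-- The letter `i * q + c` is the copy `c` of variable `i`. Division by `q` forgets the copy, and
copies may be chosen independently at every position. -/
lemma mem_words_iff {q : ℕ} (hq : 0 < q) (C : ArithFormula n) (w : List ℕ) :
    w ∈ C.words q ↔ w.map (· / q) ∈ C.words 1 := by
  induction C generalizing w with
  | var i =>
    simp only [words, List.mem_map, List.mem_range, Nat.lt_one_iff, exists_eq_left, mul_one,
      add_zero]
    constructor
    · rintro ⟨c, hc, rfl⟩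
      simp [mul_comm _ q, Nat.mul_add_div hq, Nat.div_eq_of_lt hc]
    · intro h
      obtain ⟨t, rfl⟩ := List.length_eq_one_iff.1 (by simpa using (congrArg List.length h).symm)
      simp only [List.map_cons, List.map_nil, List.cons.injEq, and_true] at h
      exact ⟨t % q, Nat.mod_lt _ hq, by rw [h, mul_comm, Nat.div_add_mod]⟩
  | sum m C ih => simp only [mem_words_sum, ih]
  | mul C D hC hD =>
    simp only [mem_words_mul, hC, hD]
    constructor
    · rintro ⟨v, hv, u, hu, rfl⟩
      exact ⟨_, hv, _, hu, by simp⟩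
    · rintro ⟨v, hv, u, hu, h⟩
      obtain ⟨v', u', rfl, rfl, rfl⟩ := List.map_eq_append_iff.1 h.symm
      exact ⟨v', hv, u', hu, rfl⟩

lemma lt_of_mem_words (C : ArithFormula n) {w : List ℕ} (hw : w ∈ C.words 1) :
    ∀ i ∈ w, i < n := by
  induction C generalizing w with
  | var i =>
    simp only [words, List.mem_map, List.mem_range, Nat.lt_one_iff, exists_eq_left] at hw
    subst hw
    simp
  | sum m C ih =>
    obtain ⟨j, hj⟩ := mem_words_sum.1 hw
    exact ih j hj
  | mul C D hC hD =>
    obtain ⟨v, hv, u, hu, rfl⟩ := mem_words_mul.1 hw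
    intro i hi
    rcases List.mem_append.1 hi with hi | hi
    · exact hD hv i hi
    · exact hC hu i hi

lemma length_le_deg (C : ArithFormula n) {w : List ℕ} (hw : w ∈ C.words 1) :
    w.length ≤ C.deg := by
  induction C generalizing w with
  | var i =>
    obtain ⟨c, -, rfl⟩ := List.mem_map.1 hw
    rfl
  | sum m C ih =>
    obtain ⟨j, hj⟩ := mem_words_sum.1 hw
    exact (ih j hj).trans (Finset.le_sup (f := fun j => (C j).deg) (Finset.mem_univ j))
  | mul C D hC hD =>
    obtain ⟨v, hv, u, hu, rfl⟩ := mem_words_mul.1 hw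
    have h₁ := hC hu
    have h₂ := hD hv
    simp only [List.length_append, deg]
    omega

lemma exists_length_eq_deg (C : ArithFormula n) : ∃ w ∈ C.words 1, w.length = C.deg := by
  induction C with
  | var i => exact ⟨[i], by simp [words], rfl⟩
  | sum m C ih =>
    obtain ⟨j, -, hj⟩ := Finset.exists_mem_eq_sup Finset.univ Finset.univ_nonempty
      fun j => (C j).deg
    obtain ⟨w, hw, h⟩ := ih j
    exact ⟨w, mem_words_sum.2 ⟨j, hw⟩, h.trans hj.symm⟩
  | mul C D hC hD =>
    obtain ⟨u, hu, h₁⟩ := hC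
    obtain ⟨v, hv, h₂⟩ := hD
    exact ⟨_, mem_words_mul.2 ⟨v, hv, u, hu, rfl⟩, by simp [deg, h₁, h₂, add_comm]⟩

lemma deg_le_size (C : ArithFormula n) : C.deg ≤ C.size := by
  induction C with
  | var i => simp [deg, size]
  | sum m C ih =>
    simp only [deg, size]
    refine (Finset.sup_le fun j _ => (ih j).trans ?_).trans (Nat.le_add_left _ _)
    exact Finset.single_le_sum (f := fun j => (C j).size) (fun _ _ => Nat.zero_le _)
      (Finset.mem_univ j)
  | mul C D hC hD => simp only [deg, size]; omega

lemma one_le_deg (C : ArithFormula n) : 1 ≤ C.deg := by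
  induction C with
  | var i => simp [deg]
  | sum m C ih => exact (ih 0).trans (Finset.le_sup (f := fun j => (C j).deg) (Finset.mem_univ 0))
  | mul C D hC hD => simp only [deg]; omega

lemma one_le_size (C : ArithFormula n) : 1 ≤ C.size := C.one_le_deg.trans C.deg_le_size

/-- The monomials of the expansion are those of the words. -/
lemma mem_support_toPoly (C : ArithFormula n) (m : Fin n →₀ ℕ) :
    m ∈ C.toPoly.support ↔ ∃ w ∈ C.words 1, ∀ i : Fin n, m i = w.count (i : ℕ) := by
  induction C generalizing m with
  | var i =>
    simp only [toPoly, words, MvPolynomial.support_X, Finset.mem_singleton, List.mem_map,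
      List.mem_range, Nat.lt_one_iff, exists_eq_left, mul_one, add_zero, exists_eq_left',
      List.count_singleton]
    constructor
    · rintro rfl j
      simp [Finsupp.single_apply, Fin.ext_iff]
    · intro h
      ext j
      simp [h j, Finsupp.single_apply, Fin.ext_iff]
  | sum r C ih =>
    -- In the natural numbers a sum vanishes only if all its terms do, so nothing cancels.
    simp only [toPoly, MvPolynomial.mem_support_iff, MvPolynomial.coeff_sum, mem_words_sum, ne_eq,
      Finset.sum_eq_zero_iff, Finset.mem_univ, true_imp_iff, not_forall]
    simp only [MvPolynomial.mem_support_iff, ne_eq] at ih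
    constructor
    · rintro ⟨j, hj⟩
      obtain ⟨w, hw, h⟩ := (ih j m).1 hj
      exact ⟨w, ⟨j, hw⟩, h⟩
    · rintro ⟨w, ⟨j, hw⟩, h⟩
      exact ⟨j, (ih j m).2 ⟨w, hw, h⟩⟩
  | mul C D hC hD =>
    simp only [toPoly, MvPolynomial.mem_support_iff, MvPolynomial.coeff_mul, ne_eq,
      Finset.sum_eq_zero_iff, not_forall, exists_prop, mul_eq_zero, not_or, mem_words_mul]
    simp only [MvPolynomial.mem_support_iff, ne_eq] at hC hD
    constructor
    · rintro ⟨⟨a, b⟩, hab, ha, hb⟩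
      obtain ⟨u, hu, h₁⟩ := (hC a).1 ha
      obtain ⟨v, hv, h₂⟩ := (hD b).1 hb
      refine ⟨_, ⟨v, hv, u, hu, rfl⟩, fun i => ?_⟩
      rw [← Finset.HasAntidiagonal.mem_antidiagonal.1 hab, List.count_append, Finsupp.add_apply, h₁, h₂, add_comm]
    · rintro ⟨_, ⟨v, hv, u, hu, rfl⟩, h⟩
      refine ⟨⟨Finsupp.equivFunOnFinite.symm fun i => u.count (i : ℕ),
        Finsupp.equivFunOnFinite.symm fun i => v.count (i : ℕ)⟩, ?_, ?_, ?_⟩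
      · rw [Finset.HasAntidiagonal.mem_antidiagonal]
        ext i
        simp [h i, add_comm]
      · exact (hC _).2 ⟨u, hu, fun i => rfl⟩
      · exact (hD _).2 ⟨v, hv, fun i => rfl⟩

end ArithFormula

/-! ### Monomials with small exponents and words without repeated letters -/

lemma List.sum_count_eq_length {n : ℕ} : ∀ {w : List ℕ}, (∀ i ∈ w, i < n) →
    ∑ i : Fin n, w.count (i : ℕ) = w.length
  | [], _ => by simp
  | a :: w, h => by
    have ha : a < n := h a (by simp)
    simp only [List.count_cons, Finset.sum_add_distrib, List.length_cons,
      List.sum_count_eq_length fun i hi => h i (List.mem_cons_of_mem a hi)]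
    rw [Finset.sum_eq_single ⟨a, ha⟩]
    · simp
    · intro b _ hb
      have : a ≠ b := fun h => hb (Fin.ext h.symm)
      simp [this]
    · simp

/-- Equal letters of a word can be replaced by distinct copies if there are enough of them. -/
lemma exists_nodup_copies {q : ℕ} : ∀ u : List ℕ, (∀ i, u.count i ≤ q) →
    ∃ w : List ℕ, w.Nodup ∧ w.map (· / q) = u ∧ ∀ t ∈ w, t % q < u.count (t / q)
  | [], _ => ⟨[], by simp⟩
  | i :: u, h => by
    obtain ⟨w, h₁, h₂, h₃⟩ := exists_nodup_copies u fun j =>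
      (List.count_le_count_cons).trans (h j)
    have hi : u.count i < q := by
      have := h i
      rw [List.count_cons_self] at this
      omega
    have hq : 0 < q := by omega
    have e₁ : (i * q + u.count i) / q = i := by
      rw [mul_comm, Nat.mul_add_div hq, Nat.div_eq_of_lt hi, add_zero]
    have e₂ : (i * q + u.count i) % q = u.count i := by
      rw [mul_comm, Nat.mul_add_mod, Nat.mod_eq_of_lt hi]
    -- The new occurrence of `i` takes as copy number the count of its later occurrences; by the
    -- third clause of the induction hypothesis that copy is still free.
    refine ⟨(i * q + u.count i) :: w, ?_, ?_, ?_⟩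
    · refine List.nodup_cons.2 ⟨fun hm => ?_, h₁⟩
      have := h₃ _ hm
      rw [e₁, e₂] at this
      omega
    · rw [List.map_cons, e₁, h₂]
    · intro t ht
      rcases List.mem_cons.1 ht with rfl | ht
      · rw [e₁, e₂, List.count_cons_self]
        omega
      · exact (h₃ t ht).trans_le List.count_le_count_cons

/-- Distinct letters with the same quotient `i` lie in an interval of length `q`. -/
lemma count_map_div_le {q : ℕ} (hq : 0 < q) {w : List ℕ} (hw : w.Nodup) (i : ℕ) :
    (w.map (· / q)).count i ≤ q := by
  rw [List.count, List.countP_map, List.countP_eq_length_filter]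
  have h₁ : (w.filter ((fun x => x == i) ∘ (· / q))).Nodup := hw.filter _
  rw [← List.toFinset_card_of_nodup h₁]
  calc _ ≤ (Finset.Ico (i * q) (i * q + q)).card := by
        refine Finset.card_le_card fun t ht => ?_
        simp only [List.mem_toFinset, List.mem_filter, Function.comp_apply, beq_iff_eq] at ht
        have h₂ := Nat.div_add_mod t q
        have h₃ := Nat.mod_lt t hq
        rw [ht.2, mul_comm] at h₂
        rw [Finset.mem_Ico]
        omega
    _ = q := by simp

namespace ArithFormula

variable {n : ℕ}

lemma degree_eq_length {C : ArithFormula n} {m : Fin n →₀ ℕ} {w : List ℕ} (hw : w ∈ C.words 1)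
    (h : ∀ i : Fin n, m i = w.count (i : ℕ)) : m.degree = w.length := by
  rw [Finsupp.degree_eq_sum, ← List.sum_count_eq_length (C.lt_of_mem_words hw)]
  exact Finset.sum_congr rfl fun i _ => h i

lemma totalDegree_toPoly (C : ArithFormula n) : C.toPoly.totalDegree = C.deg := by
  apply le_antisymm
  · refine Finset.sup_le fun m hm => ?_
    obtain ⟨w, hw, h⟩ := (C.mem_support_toPoly m).1 hm
    have := degree_eq_length hw h
    rw [Finsupp.degree] at this
    exact this.le.trans (C.length_le_deg hw)
  · obtain ⟨w, hw, h⟩ := C.exists_length_eq_deg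
    have hm : (Finsupp.equivFunOnFinite.symm fun i : Fin n => w.count (i : ℕ)) ∈
        C.toPoly.support := (C.mem_support_toPoly _).2 ⟨w, hw, fun i => rfl⟩
    have h₁ := MvPolynomial.le_totalDegree hm
    have h₂ := degree_eq_length hw (m := Finsupp.equivFunOnFinite.symm fun i : Fin n =>
      w.count (i : ℕ)) fun i => rfl
    rw [Finsupp.degree] at h₂
    rw [← h, ← h₂]
    exact h₁

/-- Testing for monomials with exponents smaller than `p` amounts to testing for words without
repeated letters once every variable has been replaced by a sum of `min (p - 1) k` letters. -/
lemma hasCMonomial_iff (C : ArithFormula n) {p k : ℕ} (hp : 2 ≤ p) (hk : 1 ≤ k) :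
    HasCMonomial p k C.toPoly ↔
      ∃ w ∈ C.words (min (p - 1) k), w.length = k ∧ w.Nodup := by
  have hq : 0 < min (p - 1) k := by omega
  constructor
  · rintro ⟨m, hm, hc, hd⟩
    obtain ⟨u, hu, h⟩ := (C.mem_support_toPoly m).1 hm
    rw [degree_eq_length hu h] at hd
    obtain ⟨w, h₁, h₂, -⟩ := exists_nodup_copies (q := min (p - 1) k) u fun i => by
      -- An exponent is at most `p - 1` by assumption and at most `k` because the word has length
      -- `k`. The cap by `k` keeps the number of copies from growing with `p`.
      refine le_min ?_ (hd ▸ List.count_le_length)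
      by_cases hi : i ∈ u
      · have hn := C.lt_of_mem_words hu i hi
        have := hc ⟨i, hn⟩ (by
          rw [Finsupp.mem_support_iff, h]
          exact (List.count_pos_iff.2 hi).ne')
        rw [h] at this
        simp only at this
        omega
      · simp [List.count_eq_zero_of_not_mem hi]
    exact ⟨w, (mem_words_iff hq C w).2 (h₂ ▸ hu), by rw [← hd, ← h₂, List.length_map], h₁⟩
  · rintro ⟨w, hw, hl, hnd⟩
    have hu := (mem_words_iff hq C w).1 hw
    set u := w.map (· / min (p - 1) k) with hu_def
    refine ⟨Finsupp.equivFunOnFinite.symm fun i : Fin n => u.count (i : ℕ),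
      (C.mem_support_toPoly _).2 ⟨u, hu, fun i => rfl⟩, fun i _ => ?_, ?_⟩
    · have := count_map_div_le hq hnd (i : ℕ)
      rw [← hu_def] at this
      change u.count (i : ℕ) < p
      omega
    · rw [degree_eq_length hu fun i => rfl, hu_def, List.length_map, hl]

/-! ### Evaluation of a formula along a graph -/

/-- The value that a formula with entry value `x` adds to the exit value `y`, if a variable `x_i`
acts by `upd i` and fresh nodes have the value `z`. -/
def flow {M : Type} (upd : ℕ → M → M → M) (z : M) : ArithFormula n → M → M → M
  | var i => upd i
  | sum _ C => fun y x => (List.ofFn fun j => (C j).flow upd z).foldl (fun y f => f y x) y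
  | mul C D => fun y x => D.flow upd z y (C.flow upd z z x)

/-- With `max` and successor the flow measures longest paths. Every terminal has length one, so a
fresh node with value `0` is harmless. -/
lemma flow_deg (C : ArithFormula n) (y x : ℕ) :
    C.flow (fun _ y x => max y (x + 1)) 0 y x = max y (x + C.deg) := by
  induction C generalizing y x with
  | var i => rfl
  | mul C D hC hD => simp [flow, hC, hD, deg, add_assoc]
  | sum m C ih =>
    have key : ∀ (l : List (Fin (m + 1))) (y : ℕ),
        (l.map fun j => (C j).flow (fun _ y x => max y (x + 1)) 0).foldl (fun y f => f y x) y =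
          l.foldl (fun y j => max y (x + (C j).deg)) y := by
      intro l
      induction l with
      | nil => simp
      | cons j l hl => intro y; simp [ih, hl]
    -- For an empty list the right side would be `max y x`; nonzero fan-in excludes this.
    have key' : ∀ (l : List (Fin (m + 1))) (y : ℕ), l ≠ [] →
        l.foldl (fun y j => max y (x + (C j).deg)) y =
          max y (x + l.toFinset.sup fun j => (C j).deg) := by
      intro l
      induction l with
      | nil => simp
      | cons j l hl =>
        intro y _
        by_cases h : l = []
        · simp [h]
        · rw [List.foldl_cons, hl _ h, List.toFinset_cons, Finset.sup_insert]
          omega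
    simp only [flow, List.ofFn_eq_map]
    rw [key, key' _ _ (by simp [List.finRange_eq_nil_iff]), deg]
    congr 3
    ext j
    simp

/-- The first factor of a product acts first and thus stands on the right of a composition of
operators; this is why `words` puts the words of `D` before those of `C`. Additivity distributes the
action over all words. -/
lemma flow_add {M : Type} [AddCommMonoid M] (A : ℕ → AddMonoid.End M) (q : ℕ)
    (C : ArithFormula n) (y x : M) :
    C.flow (fun i y x => y + ∑ c ∈ Finset.range q, A (i * q + c) x) 0 y x =
      y + ((C.words q).map fun w => (w.map A).prod x).sum := by
  induction C generalizing y x with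
  | var i =>
    simp only [flow, words, List.map_map]
    congr 1
  | mul C D hC hD =>
    simp only [flow, hC, hD, zero_add, words]
    congr 1
    generalize D.words q = L
    induction L with
    | nil => simp
    | cons v L hL =>
      simp only [List.map_cons, List.sum_cons, List.flatMap_cons, List.map_append, List.sum_append,
        hL, List.map_map]
      congr 1
      rw [map_list_sum]
      simp [Function.comp_def]
  | sum m C ih =>
    simp only [flow, words, List.ofFn_eq_map]
    generalize List.finRange (m + 1) = l
    induction l generalizing y with
    | nil => simp
    | cons j l hl => simp [ih, hl, add_assoc]

end ArithFormula

/-! ### Formulas as graphs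

A formula is turned into a list of labelled edges `(a, b, i)`: a sum joins its summands in parallel,
a product puts its factors in series. -/

/-- The edges are passed through one by one; an edge `(a, b, i)` updates the value of `b`. -/
def runEdges {M : Type} (upd : ℕ → M → M → M) (E : List (ℕ × ℕ × ℕ)) (v : ℕ → M) : ℕ → M :=
  E.foldl (fun v e => Function.update v e.2.1 (upd e.2.2 (v e.2.1) (v e.1))) v

/-- The same for edges that are labelled by formulas. -/
def runTodo {n : ℕ} {M : Type} (upd : ℕ → M → M → M) (z : M)
    (todo : List (ArithFormula n × ℕ × ℕ)) (v : ℕ → M) : ℕ → M :=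
  todo.foldl (fun v x => Function.update v x.2.2 (x.1.flow upd z (v x.2.2) (v x.2.1))) v

section

variable {n : ℕ} {M : Type} {upd : ℕ → M → M → M} {z : M}

lemma runEdges_concat (E : List (ℕ × ℕ × ℕ)) (a b i : ℕ) (v : ℕ → M) :
    runEdges upd (E ++ [(a, b, i)]) v = Function.update (runEdges upd E v) b
      (upd i (runEdges upd E v b) (runEdges upd E v a)) := by
  simp [runEdges]

lemma runEdges_of_le {N : ℕ} (E : List (ℕ × ℕ × ℕ)) (hE : ∀ e ∈ E, e.2.1 < N) {u : ℕ}
    (hu : N ≤ u) (v : ℕ → M) : runEdges upd E v u = v u := by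
  induction E using List.reverseRecOn with
  | nil => rfl
  | append_singleton E e ih =>
    obtain ⟨a, b, i⟩ := e
    have hb : b < N := hE (a, b, i) (by simp)
    rw [runEdges_concat, Function.update_of_ne (by omega), ih fun e he => hE e (by simp [he])]

/-- Pending formulas between nodes below `N` never read a node from `N` on, so what remains at the
inner node of a finished product is irrelevant. -/
lemma runTodo_congr {N : ℕ} : ∀ (todo : List (ArithFormula n × ℕ × ℕ)) {v v' : ℕ → M},
    (∀ x ∈ todo, x.2.1 < N ∧ x.2.2 < N) → (∀ u < N, v u = v' u) →
    ∀ u < N, runTodo upd z todo v u = runTodo upd z todo v' u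
  | [], _, _, _, h => h
  | (C, a, b) :: todo, v, v', ht, h => by
    have hab := ht (C, a, b) (by simp)
    refine runTodo_congr todo (fun x hx => ht x (by simp [hx])) fun u hu => ?_
    simp only [Function.update_apply, h _ hab.1, h _ hab.2, h u hu]

/-- The summands write only to `b`; as `a ≠ b`, all of them see the same entry value. -/
lemma runTodo_sum {m : ℕ} (C : Fin (m + 1) → ArithFormula n) {a b : ℕ} (hab : a ≠ b)
    (rest : List (ArithFormula n × ℕ × ℕ)) (v : ℕ → M) :
    runTodo upd z ((List.ofFn fun j => (C j, a, b)) ++ rest) v =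
      runTodo upd z ((.sum m C, a, b) :: rest) v := by
  simp only [runTodo, List.foldl_append, List.foldl_cons, ArithFormula.flow]
  congr 1
  simp only [List.ofFn_eq_map]
  generalize List.finRange (m + 1) = l
  induction l generalizing v with
  | nil => simp
  | cons j l hl => simp [hl, Function.update_of_ne hab]

/-- `C` is completed before `D` starts, so the fresh node `N` has received its full value when it is
first read. -/
lemma runTodo_mul (C D : ArithFormula n) {a b N : ℕ} (hb : b < N)
    {rest : List (ArithFormula n × ℕ × ℕ)} (hr : ∀ x ∈ rest, x.2.1 < N ∧ x.2.2 < N) {v : ℕ → M}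
    (hv : v N = z) {u : ℕ} (hu : u < N) :
    runTodo upd z ((C, a, N) :: (D, N, b) :: rest) v u =
      runTodo upd z ((.mul C D, a, b) :: rest) v u := by
  refine runTodo_congr rest hr (fun w hw => ?_) u hu
  simp only [Function.update_apply, hw.ne, hb.ne, if_false, if_true, hv, ArithFormula.flow]

/-- An edge raises the maximum by at most one; this keeps the computed degrees within the word
length. -/
lemma runEdges_deg_le (E : List (ℕ × ℕ × ℕ)) (u : ℕ) :
    runEdges (fun _ y x => max y (x + 1)) E (fun _ => 0) u ≤ E.length := by
  induction E using List.reverseRecOn generalizing u with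
  | nil => simp [runEdges]
  | append_singleton E e ih =>
    obtain ⟨a, b, i⟩ := e
    rw [runEdges_concat, Function.update_apply]
    have h₁ := ih u
    have h₂ := ih a
    have h₃ := ih b
    simp only [List.length_append, List.length_singleton]
    split_ifs <;> omega

end

/-- The list `E` of edges, together with the formulas in `todo`, between nodes smaller than `N`, is
a graph for the formula `C`, and the formulas in `todo` have `m` nodes. -/
structure PartialGraph {n : ℕ} (C : ArithFormula n) (todo : List (ArithFormula n × ℕ × ℕ))
    (E : List (ℕ × ℕ × ℕ)) (N m : ℕ) : Prop where
  two_le : 2 ≤ N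
  todo_lt : ∀ x ∈ todo, x.2.1 < N ∧ x.2.2 < N ∧ x.2.1 ≠ x.2.2
  edge_lt : ∀ e ∈ E, e.1 < N ∧ e.2.1 < N ∧ e.1 ≠ e.2.1 ∧ e.2.2 < n
  size_eq : (todo.map fun x => x.1.size).sum = m
  edges_le : E.length + m ≤ C.size
  nodes_le : N + m ≤ C.size + 2
  -- The quantification over all interpretations allows one parse to be used twice: with natural
  -- numbers for the degree and with vectors for the test.
  flow_eq : ∀ (M : Type) (upd : ℕ → M → M → M) (z : M) (v : ℕ → M), (∀ u, 2 ≤ u → v u = z) →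
    runTodo upd z todo (runEdges upd E v) 1 = C.flow upd z (v 1) (v 0)

namespace PartialGraph

variable {n : ℕ} {C : ArithFormula n} {rest : List (ArithFormula n × ℕ × ℕ)}
  {E : List (ℕ × ℕ × ℕ)} {N m a b : ℕ}

lemma start (C : ArithFormula n) : PartialGraph C [(C, 0, 1)] [] 2 C.size where
  two_le := le_rfl
  todo_lt := by simp
  edge_lt := by simp
  size_eq := by simp
  edges_le := by simp
  nodes_le := by omega
  flow_eq := by simp [runTodo, runEdges]

lemma var_step {i : Fin n} (h : PartialGraph C ((.var i, a, b) :: rest) E N (m + 1)) :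
    PartialGraph C rest (E ++ [(a, b, (i : ℕ))]) N m where
  two_le := h.two_le
  todo_lt x hx := h.todo_lt x (by simp [hx])
  edge_lt e he := by
    rcases List.mem_append.1 he with he | he
    · exact h.edge_lt e he
    · obtain ⟨h₁, h₂, h₃⟩ := h.todo_lt (.var i, a, b) (by simp)
      rw [List.mem_singleton.1 he]
      exact ⟨h₁, h₂, h₃, i.2⟩
  size_eq := by
    have := h.size_eq
    simp only [List.map_cons, List.sum_cons, ArithFormula.size] at this
    omega
  edges_le := by
    have := h.edges_le
    simp only [List.length_append, List.length_singleton]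
    omega
  nodes_le := by have := h.nodes_le; omega
  flow_eq M upd z v hv := by
    rw [runEdges_concat, ← h.flow_eq M upd z v hv]
    rfl

lemma sum_step {r : ℕ} {D : Fin (r + 1) → ArithFormula n}
    (h : PartialGraph C ((.sum r D, a, b) :: rest) E N (m + 1)) :
    PartialGraph C ((List.ofFn fun j => (D j, a, b)) ++ rest) E N m where
  two_le := h.two_le
  todo_lt x hx := by
    rcases List.mem_append.1 hx with hx | hx
    · obtain ⟨j, rfl⟩ := (List.mem_ofFn' _ _).1 hx
      exact h.todo_lt (.sum r D, a, b) (by simp)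
    · exact h.todo_lt x (by simp [hx])
  edge_lt := h.edge_lt
  size_eq := by
    have := h.size_eq
    simp only [List.map_cons, List.sum_cons, ArithFormula.size] at this
    simp only [List.map_append, List.sum_append, List.map_ofFn, List.sum_ofFn, Function.comp_apply]
    omega
  edges_le := by have := h.edges_le; omega
  nodes_le := by have := h.nodes_le; omega
  flow_eq M upd z v hv := by
    rw [runTodo_sum D (h.todo_lt (.sum r D, a, b) (by simp)).2.2, h.flow_eq M upd z v hv]

lemma mul_step {D D' : ArithFormula n}
    (h : PartialGraph C ((.mul D D', a, b) :: rest) E N (m + 1)) :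
    PartialGraph C ((D, a, N) :: (D', N, b) :: rest) E (N + 1) m where
  two_le := h.two_le.trans (Nat.le_succ N)
  todo_lt x hx := by
    have h₁ := h.todo_lt (.mul D D', a, b) (by simp)
    simp only [List.mem_cons] at hx
    simp only at h₁
    rcases hx with rfl | rfl | hx
    · simp only; omega
    · simp only; omega
    · have := h.todo_lt x (by simp [hx])
      omega
  edge_lt e he := by
    have := h.edge_lt e he
    omega
  size_eq := by
    have := h.size_eq
    simp only [List.map_cons, List.sum_cons, ArithFormula.size] at this ⊢
    omega
  edges_le := by have := h.edges_le; omega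
  nodes_le := by have := h.nodes_le; omega
  flow_eq M upd z v hv := by
    have h₁ := h.todo_lt (.mul D D', a, b) (by simp)
    rw [← h.flow_eq M upd z v hv]
    refine runTodo_mul D D' h₁.2.1 (fun x hx => ?_) ?_ h.two_le
    · have := h.todo_lt x (by simp [hx])
      exact ⟨this.1, this.2.1⟩
    · rw [runEdges_of_le E (fun e he => (h.edge_lt e he).2.1) le_rfl, hv N h.two_le]

lemma todo_eq_nil (h : PartialGraph C rest E N 0) : rest = [] := by
  cases rest with
  | nil => rfl
  | cons x l =>
    have := h.size_eq
    have := x.1.one_le_size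
    simp only [List.map_cons, List.sum_cons] at *
    omega

lemma length_le (h : PartialGraph C rest E N m) : rest.length ≤ m := by
  rw [← h.size_eq]
  simpa using List.length_le_sum_of_one_le (rest.map fun x => x.1.size) (by
    intro i hi
    obtain ⟨x, -, rfl⟩ := List.mem_map.1 hi
    exact x.1.one_le_size)

end PartialGraph

/-! ### The parser -/

namespace RAM

/-- The entries of `f` from `i` on are those of the list. -/
def ListAt (f : ℕ → ℕ) : ℕ → List ℕ → Prop
  | _, [] => True
  | i, t :: l => f i = t ∧ ListAt f (i + 1) l

/-- The two arrays hold a stack of pairs. -/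
def StackAt (f g : ℕ → ℕ) : List (ℕ × ℕ) → Prop
  | [] => True
  | x :: l => f l.length = x.1 ∧ g l.length = x.2 ∧ StackAt f g l

/-- The three arrays hold a list of edges. -/
def EdgesAt (f g h : ℕ → ℕ) (E : List (ℕ × ℕ × ℕ)) : Prop :=
  ∀ i (hi : i < E.length), f i = E[i].1 ∧ g i = E[i].2.1 ∧ h i = E[i].2.2

lemma StackAt.congr {f g f' g' : ℕ → ℕ} : ∀ {l : List (ℕ × ℕ)}, StackAt f g l →
    (∀ i < l.length, f' i = f i) → (∀ i < l.length, g' i = g i) → StackAt f' g' l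
  | [], _, _, _ => trivial
  | x :: l, h, hf, hg => by
    refine ⟨(hf _ (by simp)).trans h.1, (hg _ (by simp)).trans h.2.1, h.2.2.congr ?_ ?_⟩
    · exact fun i hi => hf i (by simp only [List.length_cons]; omega)
    · exact fun i hi => hg i (by simp only [List.length_cons]; omega)

lemma StackAt.push {f g : ℕ → ℕ} {l : List (ℕ × ℕ)} (h : StackAt f g l) (a b : ℕ) :
    StackAt (Function.update f l.length a) (Function.update g l.length b) ((a, b) :: l) :=
  ⟨by simp, by simp, h.congr (fun i hi => by simp [hi.ne]) fun i hi => by simp [hi.ne]⟩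

lemma EdgesAt.concat {f g h : ℕ → ℕ} {E : List (ℕ × ℕ × ℕ)} (hE : EdgesAt f g h E) (a b c : ℕ) :
    EdgesAt (Function.update f E.length a) (Function.update g E.length b)
      (Function.update h E.length c) (E ++ [(a, b, c)]) := by
  intro i hi
  simp only [List.length_append, List.length_singleton] at hi
  rcases Nat.lt_succ_iff_lt_or_eq.1 hi with hi | rfl
  · simp [List.getElem_append_left hi, hi.ne, hE i hi]
  · simp

infixr:60 " ;; " => Prog.seq

notation "posR" => (2 : ℕ)
notation "spR" => (3 : ℕ)
notation "nodesR" => (4 : ℕ)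
notation "edgesR" => (5 : ℕ)
notation "stackFrom" => (6 : ℕ)
notation "stackTo" => (7 : ℕ)
notation "edgeFrom" => (8 : ℕ)
notation "edgeTo" => (9 : ℕ)
notation "edgeVar" => (10 : ℕ)
notation "degA" => (11 : ℕ)
notation "fromR" => (12 : ℕ)
notation "toR" => (13 : ℕ)
notation "cntR" => (14 : ℕ)
notation "faninR" => (15 : ℕ)

def parseVar : Prog :=
  .set edgeFrom (reg edgesR) (reg fromR) ;;
  .set edgeTo (reg edgesR) (reg toR) ;;
  .set edgeVar (reg edgesR) (.get 0 (.op .add (reg posR) (.const 1))) ;;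
  -- With truncated subtraction, `y + ((x + 1) - y)` is `max y (x + 1)`.
  .set degA (reg toR) (.op .add (.get degA (reg toR))
    (.op .sub (.op .add (.get degA (reg fromR)) (.const 1)) (.get degA (reg toR)))) ;;
  .let edgesR (.op .add (reg edgesR) (.const 1)) ;;
  .let posR (.op .add (reg posR) (.const 2))

def parseMul : Prog :=
  -- The second factor is pushed first, so that the factor whose tokens come next is on top. The
  -- stack holds only end points; the formulas remain in the token stream.
  .set stackFrom (reg spR) (reg nodesR) ;;
  .set stackTo (reg spR) (reg toR) ;;
  .let spR (.op .add (reg spR) (.const 1)) ;;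
  .set stackFrom (reg spR) (reg fromR) ;;
  .set stackTo (reg spR) (reg nodesR) ;;
  .let spR (.op .add (reg spR) (.const 1)) ;;
  .let nodesR (.op .add (reg nodesR) (.const 1)) ;;
  .let posR (.op .add (reg posR) (.const 1))

def parseSum : Prog :=
  .let faninR (.get 0 (.op .add (reg posR) (.const 1))) ;;
  .let posR (.op .add (reg posR) (.const 2)) ;;
  forUpTo cntR faninR
    (.set stackFrom (reg spR) (reg fromR) ;;
     .set stackTo (reg spR) (reg toR) ;;
     .let spR (.op .add (reg spR) (.const 1)))

def parseToken : Prog :=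
  .cond (.get 0 (reg posR))
    (.cond (.op .sub (.get 0 (reg posR)) (.const 1)) parseMul parseSum) parseVar

def parseNode : Prog :=
  .let spR (.op .sub (reg spR) (.const 1)) ;;
  .let fromR (.get stackFrom (reg spR)) ;;
  .let toR (.get stackTo (reg spR)) ;;
  parseToken

/-- Reads the formula from the input and writes down the edges of a graph for it, together with the
degrees of the nodes. -/
def parse : Prog :=
  -- Entries `0`, `1`, `2` of the input array hold the length, `p` and `n`. The bottom of the stack
  -- is the pair `(0, 1)`, whose first component is already `0`.
  .let posR (.const 3) ;;
  .let spR (.const 1) ;;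
  .let nodesR (.const 2) ;;
  .set stackTo (.const 0) (.const 1) ;;
  .loop (reg spR) parseNode

/-- The memory while the formula is parsed. -/
structure Parsing {n : ℕ} (C : ArithFormula n) (todo : List (ArithFormula n × ℕ × ℕ))
    (E : List (ℕ × ℕ × ℕ)) (m : ℕ) (σ : State) : Prop where
  graph : PartialGraph C todo E (σ nodesR 0) m
  sp : σ spR 0 = todo.length
  stack : StackAt (σ stackFrom) (σ stackTo) (todo.map Prod.snd)
  tokens : ListAt (σ 0) (σ posR 0) (todo.flatMap fun x => x.1.encode)
  -- Every node consumes at most two tokens, which bounds the read position.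
  pos : σ posR 0 + 2 * m ≤ 2 * C.size + 3
  count : σ edgesR 0 = E.length
  edges : EdgesAt (σ edgeFrom) (σ edgeTo) (σ edgeVar) E
  degree : σ degA = runEdges (fun _ y x => max y (x + 1)) E fun _ => 0

section

variable {n : ℕ} {C : ArithFormula n} {rest : List (ArithFormula n × ℕ × ℕ)}
  {E : List (ℕ × ℕ × ℕ)} {m a b R : ℕ} {σ : State}

/-- The memory after the topmost entry `(a, b)` of the stack has been removed. -/
structure Popped (C : ArithFormula n) (D : ArithFormula n) (a b : ℕ)
    (rest : List (ArithFormula n × ℕ × ℕ))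
    (E : List (ℕ × ℕ × ℕ)) (m : ℕ) (σ : State) : Prop where
  graph : PartialGraph C ((D, a, b) :: rest) E (σ nodesR 0) m
  source : σ fromR 0 = a
  target : σ toR 0 = b
  sp : σ spR 0 = rest.length
  stack : StackAt (σ stackFrom) (σ stackTo) (rest.map Prod.snd)
  tokens : ListAt (σ 0) (σ posR 0) (D.encode ++ rest.flatMap fun x => x.1.encode)
  pos : σ posR 0 + 2 * m ≤ 2 * C.size + 3
  count : σ edgesR 0 = E.length
  edges : EdgesAt (σ edgeFrom) (σ edgeTo) (σ edgeVar) E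
  degree : σ degA = runEdges (fun _ y x => max y (x + 1)) E fun _ => 0

lemma runs_parseVar (hσ : Bounded R σ) (hR : 2 * C.size + 3 < 2 ^ R) {i : Fin n}
    (h : Popped C (.var i) a b rest E (m + 1) σ) :
    Runs R parseVar σ 6 (Parsing C rest (E ++ [(a, b, (i : ℕ))]) m) := by
  unfold parseVar
  obtain ⟨h0, h1, h2, h3, h4, h5, h6, h7, h8, h9⟩ := h
  have hlen := h0.edges_le
  have hpos := h0.nodes_le
  have hd₁ := runEdges_deg_le E a
  have hd₂ := runEdges_deg_le E b
  simp only [ArithFormula.encode, List.cons_append, List.nil_append, ListAt] at h5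
  obtain ⟨t₁, t₂, t₃⟩ := h5
  refine .get_seq hσ fun hσ => .get_seq hσ fun hσ =>
    .get_seq hσ fun hσ => .set_seq hσ ?_ fun hσ => .set_seq hσ ?_ fun hσ => .set hσ ?_ ?_
  · simp [Expr.eval, Op.eval, write_self, write_of_ne, h1, h2, h7, h9]
    omega
  · simp [Expr.eval, Op.eval, write_self, write_of_ne, h1, h2, h7, h9]
    omega
  · simp [Expr.eval, Op.eval, write_self, write_of_ne, h1, h2, h7, h9]
    omega
  · refine ⟨?_, ?_, ?_, ?_, ?_, ?_, ?_, ?_⟩ <;>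
      simp [Expr.eval, Op.eval, write_self, write_of_ne, h1, h2, h3, h4, h7, h9, t₂]
    · exact h0.var_step
    · exact t₃
    · omega
    · exact h8.concat a b i
    · rw [runEdges_concat]
      congr 1
      omega

lemma runs_parseMul (hσ : Bounded R σ) (hR : 2 * C.size + 3 < 2 ^ R) {D D' : ArithFormula n}
    (h : Popped C (.mul D D') a b rest E (m + 1) σ) :
    Runs R parseMul σ 8
      (Parsing C ((D, a, σ nodesR 0) :: (D', σ nodesR 0, b) :: rest) E m) := by
  unfold parseMul
  obtain ⟨h0, h1, h2, h3, h4, h5, h6, h7, h8, h9⟩ := h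
  have hlen := h0.mul_step.length_le
  have hlen' := h0.edges_le
  have hpos := h0.nodes_le
  simp only [ArithFormula.encode, List.cons_append, ListAt, List.append_assoc,
    List.length_cons] at h5 hlen
  obtain ⟨t₁, t₂⟩ := h5
  refine .get_seq hσ fun hσ => .get_seq hσ fun hσ =>
    .set_seq hσ ?_ fun hσ => .get_seq hσ fun hσ => .get_seq hσ fun hσ =>
    .set_seq hσ ?_ fun hσ => .set_seq hσ ?_ fun hσ => .set hσ ?_ ?_
  · simp [Expr.eval, Op.eval, write_self, write_of_ne, h3]
    omega
  · simp [Expr.eval, Op.eval, write_self, write_of_ne, h3]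
    omega
  · simp [Expr.eval, Op.eval, write_self, write_of_ne]
    omega
  · simp [Expr.eval, Op.eval, write_self, write_of_ne]
    omega
  · refine ⟨?_, ?_, ?_, ?_, ?_, ?_, ?_, ?_⟩ <;>
      simp [Expr.eval, Op.eval, write_self, write_of_ne, h1, h2, h3, h7, h9]
    · exact h0.mul_step
    · simpa using (h4.push (σ nodesR 0) b).push a (σ nodesR 0)
    · simpa using t₂
    · omega
    · exact h8

lemma runs_parseSum (hσ : Bounded R σ) (hR : 2 * C.size + 3 < 2 ^ R) {r : ℕ}
    {D : Fin (r + 1) → ArithFormula n} (h : Popped C (.sum r D) a b rest E (m + 1) σ) :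
    Runs R parseSum σ (5 * C.size + 4)
      (Parsing C ((List.ofFn fun j => (D j, a, b)) ++ rest) E m) := by
  unfold parseSum
  obtain ⟨h0, h1, h2, h3, h4, h5, h6, h7, h8, h9⟩ := h
  have hlen := h0.sum_step.length_le
  have hlen' := h0.edges_le
  have hpos := h0.nodes_le
  simp only [ArithFormula.encode, List.cons_append, ListAt, List.append_assoc,
    List.length_append, List.length_ofFn] at h5 hlen
  obtain ⟨t₁, t₂, t₃⟩ := h5
  refine (Runs.get_seq (T := 1 + ((r + 1) * (3 + 2) + 2)) hσ fun hσ =>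
    .set_seq hσ ?_ fun hσ =>
    (Runs.forUpTo (n := r + 1) (T := 3) hσ (by decide) (by decide) (by decide) ?_
      -- All operands share the end points of the sum, so the loop stacks `i` copies of one pair
      -- without looking at the operands.
      (fun i τ => τ spR 0 = rest.length + i ∧ τ fromR 0 = a ∧ τ toR 0 = b ∧
        StackAt (τ stackFrom) (τ stackTo) (List.replicate i (a, b) ++ rest.map Prod.snd))
      ?_ ?_).mono le_rfl ?_).mono ?_ fun _ _ _ h => h
  · simp [Expr.eval, Op.eval, write_self, write_of_ne]
    omega
  · simp [Expr.eval, Op.eval, write_self, write_of_ne, t₂]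
  · simp [write_self, write_of_ne, h1, h2, h3, h4]
  · rintro i τ hi hτ - - ⟨g1, g2, g3, g4⟩
    refine .get_seq hτ fun hτ => .get_seq hτ fun hτ => .set hτ ?_ ?_
    · simp [Expr.eval, Op.eval, write_of_ne, g1]
      omega
    · simp [Expr.eval, Op.eval, write_self, write_of_ne, g1, g2, g3, List.replicate_succ]
      refine ⟨by omega, ?_⟩
      have := g4.push a b
      simpa [add_comm] using this
  · rintro τ hτ hf ⟨g1, g2, g3, g4⟩
    have hf' : ∀ c, c ∉ [cntR, stackFrom, stackTo, spR] →
        τ c = _ := fun c hc => hf c (by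
          simp [forUpTo, Prog.targets] at hc ⊢
          omega)
    refine ⟨?_, ?_, ?_, ?_, ?_, ?_, ?_, ?_⟩ <;>
      simp [hf', Expr.eval, Op.eval, write_self, write_of_ne, h7, h9, -List.ofFn_succ]
    · exact h0.sum_step
    · rw [g1, add_comm]
    · simpa [Function.comp_def, List.ofFn_const, -List.ofFn_succ] using g4
    · simpa [List.flatMap, Function.comp_def, -List.ofFn_succ] using t₃
    · omega
    · exact h8
  · omega

lemma runs_parseToken (hσ : Bounded R σ) (hR : 2 * C.size + 3 < 2 ^ R) {D : ArithFormula n}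
    (h : Popped C D a b rest E (m + 1) σ) :
    Runs R parseToken σ (5 * C.size + 10) fun τ => ∃ todo E, Parsing C todo E m τ := by
  have ht := h.tokens
  refine (?_ : Runs R parseToken σ (1 + (1 + (5 * C.size + 8))) _).mono (by omega)
    fun _ _ _ h => h
  unfold parseToken
  cases D with
  | var i =>
    simp only [ArithFormula.encode, List.cons_append, ListAt] at ht
    refine .cond hσ (fun h => absurd ht.1 h) fun _ => ?_
    exact (runs_parseVar hσ hR h).mono (by omega) fun τ _ _ h => ⟨_, _, h⟩
  | mul D D' =>
    simp only [ArithFormula.encode, List.cons_append, ListAt] at ht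
    refine .cond hσ (fun _ => .cond hσ (fun _ => ?_) fun h' => ?_) fun h' => ?_
    · exact (runs_parseMul hσ hR h).mono (by omega) fun τ _ _ h => ⟨_, _, h⟩
    · simp [Expr.eval, Op.eval, ht.1] at h'
    · simp [Expr.eval, ht.1] at h'
  | sum r D =>
    simp only [ArithFormula.encode, List.cons_append, ListAt] at ht
    refine .cond hσ (fun _ => .cond hσ (fun h' => ?_) fun _ => ?_) fun h' => ?_
    · simp [Expr.eval, Op.eval, ht.1] at h'
    · exact (runs_parseSum hσ hR h).mono (by omega) fun τ _ _ h => ⟨_, _, h⟩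
    · simp [Expr.eval, ht.1] at h'

lemma runs_parseNode (hσ : Bounded R σ) (hR : 2 * C.size + 3 < 2 ^ R)
    (h : ∃ todo E, Parsing C todo E (m + 1) σ) :
    σ spR 0 ≠ 0 ∧
      Runs R parseNode σ (5 * C.size + 20) fun τ => ∃ todo E, Parsing C todo E m τ := by
  obtain ⟨todo, E, h0, h3, h4, h5, h6, h7, h8, h9⟩ := h
  cases todo with
  | nil => have := h0.size_eq; simp at this
  | cons x rest =>
  obtain ⟨D, a, b⟩ := x
  refine ⟨by simp [h3], ?_⟩
  have hlen := h0.length_le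
  have hpos := h0.nodes_le
  simp only [List.length_cons] at hlen h3
  simp only [List.map_cons, StackAt, List.length_map] at h4
  refine (Runs.set_seq (T := 1 + (1 + (5 * C.size + 10))) hσ ?_ fun hσ =>
    .get_seq hσ fun hσ => .get_seq hσ fun hσ => runs_parseToken (D := D) (a := a) (b := b)
      (rest := rest) (E := E) hσ hR ?_).mono
    (by omega) fun _ _ _ h => h
  · simp [Expr.eval, Op.eval, h3]
    omega
  · refine ⟨?_, ?_, ?_, ?_, ?_, ?_, ?_, ?_, ?_, ?_⟩ <;>
      simp [Expr.eval, Op.eval, write_self, write_of_ne, h3, h4, h7, h9]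
    · exact h0
    · simpa using h5
    · exact h6
    · exact h8

lemma listAt_init (l : List ℕ) (pre : List ℕ) : ListAt (init (pre ++ l) 0) (pre.length + 1) l := by
  induction l generalizing pre with
  | nil => trivial
  | cons t l ih =>
    refine ⟨by simp [init], ?_⟩
    simpa using ih (pre ++ [t])

lemma runs_parse {p : ℕ} (hσ : Bounded R (init (p :: n :: C.encode)))
    (hR : 2 * C.size + 3 < 2 ^ R) :
    Runs R parse (init (p :: n :: C.encode)) (C.size * (5 * C.size + 21) + 5)
      fun τ => ∃ E, Parsing C [] E 0 τ := by
  refine (Runs.set_seq (T := 1 + (1 + (1 + (C.size * (1 + (5 * C.size + 20)) + 1)))) hσ ?_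
    fun hσ => .set_seq hσ ?_ fun hσ => .set_seq hσ ?_ fun hσ => .set_seq hσ ?_ fun hσ =>
      (Runs.loop (T := 5 * C.size + 20) (fun m τ => ∃ todo E, Parsing C todo E m τ) ?_ ?_ C.size _
        hσ ?_).mono le_rfl ?_).mono ?_ fun _ _ _ h => h
  · simp only [Expr.eval]; omega
  · simp only [Expr.eval]; omega
  · simp only [Expr.eval]; omega
  · simp only [Expr.eval]; omega
  · rintro τ ⟨todo, E, h⟩
    have := h.graph.todo_eq_nil
    subst this
    simpa [Expr.eval] using h.sp
  · exact fun m τ hτ h => runs_parseNode hτ hR h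
  · refine ⟨[(C, 0, 1)], [], ?_⟩
    refine ⟨?_, ?_, ?_, ?_, ?_, ?_, ?_, ?_⟩ <;>
      simp [Expr.eval, write_self, write_of_ne, init, StackAt, EdgesAt]
    · exact PartialGraph.start C
    · exact listAt_init C.encode [p, n]
    · omega
    · rfl
  · rintro τ - - ⟨todo, E, h⟩
    have := h.graph.todo_eq_nil
    subst this
    exact ⟨E, h⟩
  · apply le_of_eq; ring

end

end RAM

/-! ### Vectors of integers in memory

An integer is kept as the difference of two natural numbers in neighbouring entries of an array. -/

namespace RAM

/-- The `i`-th integer in an array. -/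
def diff (f : ℕ → ℕ) (i : ℕ) : ℤ := (f (i * 2) : ℤ) - f (i * 2 + 1)

lemma mul_add_ne {a b s u v : ℕ} (hab : a ≠ b) (hu : u < s) (hv : v < s) : a * s + u ≠ b * s + v := by
  intro h
  have h₁ : (a * s + u) / s = a := by
    rw [mul_comm, Nat.mul_add_div (by omega), Nat.div_eq_of_lt hu, add_zero]
  have h₂ : (b * s + v) / s = b := by
    rw [mul_comm, Nat.mul_add_div (by omega), Nat.div_eq_of_lt hv, add_zero]
  exact hab (by rw [← h₁, ← h₂, h])

notation "degR" => (16 : ℕ)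
notation "copiesR" => (17 : ℕ)
notation "powR" => (18 : ℕ)
notation "sqR" => (19 : ℕ)
notation "vecA" => (20 : ℕ)
notation "edgeR" => (21 : ℕ)
notation "copyR" => (22 : ℕ)
notation "cellR" => (23 : ℕ)
notation "columnR" => (24 : ℕ)
notation "maskR" => (25 : ℕ)
notation "otherR" => (26 : ℕ)
notation "entryR" => (27 : ℕ)
notation "bitR" => (28 : ℕ)
notation "signR" => (29 : ℕ)
notation "digitR" => (30 : ℕ)
notation "letterR" => (31 : ℕ)
notation "coeffR" => (32 : ℕ)

/-- Twice the number of the integer that is computed by `cell`. -/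
def targetE : Expr :=
  .op .mul (.op .add (.op .mul (reg toR) (reg sqR)) (reg cellR)) (.const 2)

/-- Twice the number of the integer that is added by `column`. -/
def sourceE : Expr :=
  .op .mul (.op .add (.op .mul (reg fromR) (reg sqR))
    (.op .add (.op .mul (.op .sub (reg maskR) (reg bitR)) (reg powR)) (reg otherR))) (.const 2)

/-- A summand of an expansion along a row. -/
def column : Prog :=
  -- The machine has no remainder operation; this is the lowest bit of `maskR / bitR`. If it is `0`,
  -- the truncated mask in `sourceE` still addresses a valid cell, and the coefficient `0` removes
  -- it.
  .let digitR (.op .sub (.op .div (reg maskR) (reg bitR))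
    (.op .mul (.const 2) (.op .div (.op .div (reg maskR) (reg bitR)) (.const 2)))) ;;
  .let coeffR (.op .mul (reg digitR) (reg entryR)) ;;
  -- A negative sign exchanges the two entries that receive the positive and the negative part, so
  -- nothing is ever subtracted.
  .set vecA (.op .add targetE (reg signR)) (.op .add (.get vecA (.op .add targetE (reg signR)))
    (.op .mul (reg coeffR) (.get vecA sourceE))) ;;
  .set vecA (.op .add targetE (.op .sub (.const 1) (reg signR)))
    (.op .add (.get vecA (.op .add targetE (.op .sub (.const 1) (reg signR))))
      (.op .mul (reg coeffR) (.get vecA (.op .add sourceE (.const 1))))) ;;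
  -- Exclusive or of two bits: `s + d - 2 * s * d`.
  .let signR (.op .sub (.op .add (reg signR) (reg digitR))
    (.op .mul (.const 2) (.op .mul (reg signR) (reg digitR)))) ;;
  .let entryR (.op .mul (reg entryR) (reg letterR)) ;;
  .let bitR (.op .mul (reg bitR) (.const 2))

/-- An expansion along a row. -/
def cell : Prog :=
  .let otherR (.op .div (reg cellR) (reg powR)) ;;
  .let maskR (.op .sub (reg cellR) (.op .mul (reg otherR) (reg powR))) ;;
  .let entryR (.const 1) ;;
  .let bitR (.const 1) ;;
  .let signR (.const 0) ;;
  forUpTo columnR degR column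

/-- Adds the image under `halfStep` of the vector of a node to the vector of another node. -/
def halfStepProg : Prog := forUpTo cellR sqR cell

section

variable {R k t a b z B K : ℕ} {σ : State}

/-- The registers that `cell` uses. -/
structure CellRegs (k t a b z : ℕ) (σ : State) : Prop where
  deg : σ degR 0 = k
  letter : σ letterR 0 = t
  source : σ fromR 0 = a
  target : σ toR 0 = b
  pow : σ powR 0 = 2 ^ k
  sq : σ sqR 0 = 2 ^ k * 2 ^ k
  cell : σ cellR 0 = z

/-- The memory after `j` summands of an expansion along a row, where `f` is the initial content of
the array of vectors. -/
structure Expanding (k t a b z B K : ℕ) (f : ℕ → ℕ) (j : ℕ) (σ : State) : Prop where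
  entry : σ entryR 0 = t ^ j
  bit : σ bitR 0 = 2 ^ j
  sign : σ signR 0 = lowBits (z % 2 ^ k) j % 2
  other : ∀ i, i ≠ (b * (2 ^ k * 2 ^ k) + z) * 2 → i ≠ (b * (2 ^ k * 2 ^ k) + z) * 2 + 1 →
    σ vecA i = f i
  diff_eq : diff (σ vecA) (b * (2 ^ k * 2 ^ k) + z) = diff f (b * (2 ^ k * 2 ^ k) + z) +
    ∑ i ∈ Finset.range j, (z % 2 ^ k / 2 ^ i % 2 : ℕ) * (-1) ^ lowBits (z % 2 ^ k) i * (t : ℤ) ^ i *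
      diff f (a * (2 ^ k * 2 ^ k) + ((z % 2 ^ k - 2 ^ i) * 2 ^ k + z / 2 ^ k))
  pos_le : σ vecA ((b * (2 ^ k * 2 ^ k) + z) * 2) ≤ B + j * (K * B)
  neg_le : σ vecA ((b * (2 ^ k * 2 ^ k) + z) * 2 + 1) ≤ B + j * (K * B)

/-- Either part of the target grows by at most `K * B`, since the coefficient is at most `K` and the
source entries are at most `B`. -/
lemma runs_column {f : ℕ → ℕ} {j : ℕ} (hσ : Bounded R σ) (hr : CellRegs k t a b z σ)
    (hm : σ maskR 0 = z % 2 ^ k) (ho : σ otherR 0 = z / 2 ^ k) (hab : a ≠ b)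
    (hz : z < 2 ^ k * 2 ^ k) (hj : j < k)
    (hf : ∀ u < 2 ^ k * 2 ^ k, f ((a * (2 ^ k * 2 ^ k) + u) * 2) ≤ B ∧
      f ((a * (2 ^ k * 2 ^ k) + u) * 2 + 1) ≤ B)
    (hK : ∀ i ≤ k, t ^ i ≤ K) (hKR : K < 2 ^ R) (hBR : B + k * (K * B) < 2 ^ R) (hkR : 2 ^ k < 2 ^ R)
    (h : Expanding k t a b z B K f j σ) :
    Runs R column σ 7 (Expanding k t a b z B K f (j + 1)) := by
  obtain ⟨r1, r2, r3, r4, r5, r6, r7⟩ := hr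
  obtain ⟨g1, g2, g3, g4, g5, g6, g7⟩ := h
  set x := z % 2 ^ k with hx
  set y := z / 2 ^ k with hy
  set d := b * (2 ^ k * 2 ^ k) + z with hd
  set u := (x - 2 ^ j) * 2 ^ k + y with hu
  set s := a * (2 ^ k * 2 ^ k) + u with hs
  have hxk : x < 2 ^ k := Nat.mod_lt _ (by positivity)
  have hyk : y < 2 ^ k := Nat.div_lt_of_lt_mul hz
  have huk : u < 2 ^ k * 2 ^ k := by
    have h₃ : x - 2 ^ j + 1 ≤ 2 ^ k := Nat.succ_le_of_lt ((Nat.sub_le _ _).trans_lt hxk)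
    calc u < (x - 2 ^ j) * 2 ^ k + 2 ^ k := by omega
      _ = (x - 2 ^ j + 1) * 2 ^ k := by ring
      _ ≤ _ := Nat.mul_le_mul_right _ h₃
  -- Different nodes own disjoint blocks, so the source still has its initial content `f`.
  have hsd : s ≠ d := mul_add_ne hab huk hz
  have s₁ : σ vecA (s * 2) = f (s * 2) := g4 _ (by omega) (by omega)
  have s₂ : σ vecA (s * 2 + 1) = f (s * 2 + 1) := g4 _ (by omega) (by omega)
  obtain ⟨b₁, b₂⟩ := hf u huk
  set β := x / 2 ^ j % 2 with hβ
  have hdig : x / 2 ^ j - 2 * (x / 2 ^ j / 2) = β := by omega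
  have hβ1 : β ≤ 1 := by omega
  have ht := hK j hj.le
  have ht' := hK (j + 1) hj
  have hlow : lowBits x (j + 1) = lowBits x j + β := by rw [lowBits, Finset.sum_range_succ]; rfl
  have hc : β * t ^ j ≤ K := (Nat.mul_le_mul hβ1 ht).trans (one_mul K).le
  have c₁ : β * t ^ j * f (s * 2) ≤ K * B := Nat.mul_le_mul hc b₁
  have c₂ : β * t ^ j * f (s * 2 + 1) ≤ K * B := Nat.mul_le_mul hc b₂
  have hjk : B + j * (K * B) + K * B ≤ B + k * (K * B) := by
    have : (j + 1) * (K * B) ≤ k * (K * B) := Nat.mul_le_mul_right _ hj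
    rw [add_mul] at this
    omega
  have hpk : 2 ^ j * 2 ≤ 2 ^ k := by
    rw [← pow_succ]
    exact Nat.pow_le_pow_right (by norm_num) hj
  have hj₁ : (j + 1) * (K * B) = j * (K * B) + K * B := by ring
  obtain ⟨ε, hε⟩ : ∃ ε, lowBits x j % 2 = ε := ⟨_, rfl⟩
  have hε2 : ε < 2 := hε ▸ Nat.mod_lt _ (by norm_num)
  rw [hε] at g3
  have n₁ : d * 2 + (1 - ε) ≠ d * 2 + ε := by omega
  have n₂ : s * 2 + 1 ≠ d * 2 + ε := by omega
  have v₁ : σ vecA (d * 2 + ε) ≤ B + j * (K * B) := by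
    obtain rfl | rfl : ε = 0 ∨ ε = 1 := by omega
    exacts [g6, g7]
  have v₂ : σ vecA (d * 2 + (1 - ε)) ≤ B + j * (K * B) := by
    obtain rfl | rfl : ε = 0 ∨ ε = 1 := by omega
    exacts [g7, g6]
  have hsg : ε + β - 2 * (ε * β) = lowBits x (j + 1) % 2 := by
    rw [hlow, Nat.add_mod, hε]
    obtain rfl | rfl : ε = 0 ∨ ε = 1 := by omega
    all_goals omega
  unfold column
  refine .set_seq hσ ?_ fun hσ => .set_seq hσ ?_ fun hσ => .set_seq hσ ?_ fun hσ =>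
    .set_seq hσ ?_ fun hσ => .set_seq hσ ?_ fun hσ => .set_seq hσ ?_ fun hσ => .set hσ ?_ ?_ <;>
    clear hσ <;>
    simp only [Expr.eval, Op.eval, targetE, sourceE, write_self, write_of_ne, r1, r2, r3, r4, r5,
      r6, r7, g1, g2, g3, hm, ho, ← hd, ← hu, ← hs, s₁, s₂, hdig, ne_eq, Nat.reduceEqDiff,
      not_false_eq_true, Function.update_self, Function.update_of_ne n₁, Function.update_of_ne n₂]
  · omega
  · omega
  · omega
  · omega
  · omega
  · rw [← pow_succ]; omega
  · omega
  refine ⟨?_, ?_, ?_, ?_, ?_, ?_, ?_⟩ <;>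
    simp only [write_self, write_of_ne, ne_eq, Nat.reduceEqDiff, not_false_eq_true,
      Function.update_self, ← hx, ← hy, ← hd]
  · rw [pow_succ]
  · rw [pow_succ]
  · exact hsg
  · intro i h₁ h₂
    rw [Function.update_of_ne (by omega), Function.update_of_ne (by omega), g4 i h₁ h₂]
  · rw [Finset.sum_range_succ, ← add_assoc, ← g5, neg_one_pow_eq_pow_mod_two (lowBits x j), hε]
    obtain rfl | rfl : ε = 0 ∨ ε = 1 := by omega
    · simp [diff, Function.update_apply, ← hs, ← hu, ← hβ]
      ring
    · simp [diff, Function.update_apply, ← hs, ← hu, ← hβ]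
      ring
  · rw [hj₁]
    obtain rfl | rfl : ε = 0 ∨ ε = 1 := by omega
    · simp [Function.update_apply] at v₁ ⊢
      omega
    · simp [Function.update_apply] at v₂ ⊢
      omega
  · rw [hj₁]
    obtain rfl | rfl : ε = 0 ∨ ε = 1 := by omega
    · simp [Function.update_apply] at v₂ ⊢
      omega
    · simp [Function.update_apply] at v₁ ⊢
      omega

lemma runs_cell (hσ : Bounded R σ) (hr : CellRegs k t a b z σ) (hab : a ≠ b)
    (hz : z < 2 ^ k * 2 ^ k)
    (ha : ∀ u < 2 ^ k * 2 ^ k, σ vecA ((a * (2 ^ k * 2 ^ k) + u) * 2) ≤ B ∧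
      σ vecA ((a * (2 ^ k * 2 ^ k) + u) * 2 + 1) ≤ B)
    (hb : σ vecA ((b * (2 ^ k * 2 ^ k) + z) * 2) ≤ B ∧
      σ vecA ((b * (2 ^ k * 2 ^ k) + z) * 2 + 1) ≤ B)
    (hK : ∀ i ≤ k, t ^ i ≤ K) (hKR : K < 2 ^ R) (hBR : B + k * (K * B) < 2 ^ R)
    (hkR : 2 ^ k < 2 ^ R) :
    Runs R cell σ (9 * k + 7) (Expanding k t a b z B K (σ vecA) k) := by
  obtain ⟨r1, r2, r3, r4, r5, r6, r7⟩ := hr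
  have hzR : z < 2 ^ R := r7 ▸ hσ.2 _ _
  have hmod : z - z / 2 ^ k * 2 ^ k = z % 2 ^ k := by
    have := Nat.div_add_mod z (2 ^ k)
    rw [mul_comm] at this
    omega
  have hdl := Nat.div_le_self z (2 ^ k)
  have hml := Nat.mod_le z (2 ^ k)
  have hR : 1 < 2 ^ R := Nat.one_le_two_pow.trans_lt hkR
  unfold cell
  refine (Runs.set_seq (T := 1 + (1 + (1 + (1 + (k * (7 + 2) + 2))))) hσ ?_ fun hσ =>
    .set_seq hσ ?_ fun hσ => .set_seq hσ ?_ fun hσ => .set_seq hσ ?_ fun hσ => .set_seq hσ ?_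
    fun hσ' => Runs.forUpTo (n := k) (T := 7) hσ' (by decide) (by decide) (by decide) ?_
      (Expanding k t a b z B K (σ vecA)) ?_ ?_).mono (by omega) fun _ _ _ h => h
  · simp [Expr.eval, Op.eval, r5, r7]; omega
  · simp [Expr.eval, Op.eval, write_self, write_of_ne, r5, r7, hmod]; omega
  · simpa only [Expr.eval] using hR
  · simpa only [Expr.eval] using hR
  · simp only [Expr.eval]; omega
  · simp [write_self, write_of_ne, r1]
  · refine ⟨?_, ?_, ?_, ?_, ?_, ?_, ?_⟩ <;>
      simp [Expr.eval, Op.eval, write_self, write_of_ne, lowBits, hb]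
  · intro i τ hi hτ _ hf h
    simp only [Expr.eval, Op.eval, write_self, write_of_ne, r5, r7, hmod, ne_eq, Nat.reduceEqDiff,
      not_false_eq_true, Function.update_self] at hf
    have hf' : ∀ c, c ∉ [columnR, digitR, coeffR, vecA, signR, entryR, bitR] → τ c = _ :=
      fun c hc => hf c (by simp at hc; omega) (by simp [column, Prog.targets] at hc ⊢; omega)
    refine (runs_column hτ ⟨?_, ?_, ?_, ?_, ?_, ?_, ?_⟩ ?_ ?_ hab hz hi ha hK hKR hBR hkR h).mono
      le_rfl fun τ' _ _ h' => ?_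
    all_goals try
      rw [hf' _ (by decide)]
      simp [write_self, write_of_ne, r1, r2, r3, r4, r5, r6, r7]
    obtain ⟨g1, g2, g3, g4, g5, g6, g7⟩ := h'
    exact ⟨by simpa [write_of_ne] using g1, by simpa [write_of_ne] using g2,
      by simpa [write_of_ne] using g3, by simpa [write_of_ne] using g4,
      by simpa [write_of_ne] using g5, by simpa [write_of_ne] using g6,
      by simpa [write_of_ne] using g7⟩

end

end RAM

/-! ### The action of letters and edges on the vectors in memory -/

namespace RAM

section

variable {R k t a b B K : ℕ} {σ : State}

/-- The content `g` of the array of vectors after `m` entries of a `halfStep` from node `a` to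
node `b`, where `f` is the initial content. -/
structure Stepping (k t a b B : ℕ) (f : ℕ → ℕ) (m : ℕ) (g : ℕ → ℕ) : Prop where
  other : ∀ i, (∀ z < m, i ≠ (b * (2 ^ k * 2 ^ k) + z) * 2 ∧
    i ≠ (b * (2 ^ k * 2 ^ k) + z) * 2 + 1) → g i = f i
  diff_eq : ∀ z < m, diff g (b * (2 ^ k * 2 ^ k) + z) = diff f (b * (2 ^ k * 2 ^ k) + z) +
    halfStep k t (fun u => diff f (a * (2 ^ k * 2 ^ k) + u)) z
  le : ∀ i, g i ≤ B

/-- Each cell of the target block is expanded once, from a block that is not written to. Hence the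
cells do not interfere, and all bounds grow by the factor `1 + k * K` of a single expansion. -/
lemma runs_halfStepProg (hσ : Bounded R σ) (h₁ : σ degR 0 = k) (h₂ : σ letterR 0 = t)
    (h₃ : σ fromR 0 = a) (h₄ : σ toR 0 = b) (h₅ : σ powR 0 = 2 ^ k)
    (h₆ : σ sqR 0 = 2 ^ k * 2 ^ k) (hab : a ≠ b) (hB : ∀ i, σ vecA i ≤ B)
    (hK : ∀ i ≤ k, t ^ i ≤ K) (hKR : K < 2 ^ R) (hBR : B * (1 + k * K) < 2 ^ R)
    (hkR : 2 ^ k < 2 ^ R) :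
    Runs R halfStepProg σ (2 ^ k * 2 ^ k * (9 * k + 9) + 2) fun τ =>
      Stepping k t a b (B * (1 + k * K)) (σ vecA) (2 ^ k * 2 ^ k) (τ vecA) := by
  have hBK : B * (1 + k * K) = B + k * (K * B) := by ring
  refine (Runs.forUpTo (n := 2 ^ k * 2 ^ k) (T := 9 * k + 7) hσ (by decide) (by decide) (by decide)
    h₆ (fun m τ => Stepping k t a b (B * (1 + k * K)) (σ vecA) m (τ vecA)) ?_ ?_).mono le_rfl
    fun _ _ _ h => h
  · rw [write_of_ne (by decide)]
    refine ⟨fun _ _ => rfl, by simp, fun i => (hB i).trans ?_⟩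
    rw [hBK]
    omega
  · intro z τ hz hτ hr hf h
    have hf' : ∀ c ∈ [degR, letterR, fromR, toR, powR, sqR], τ c = σ c := by
      intro c hc
      refine hf c ?_ ?_
      · rintro rfl; revert hc; decide
      · intro hc'; revert hc; fin_cases hc' <;> decide
    have hr' : CellRegs k t a b z τ := by
      refine ⟨?_, ?_, ?_, ?_, ?_, ?_, hr⟩ <;> rw [hf' _ (by decide)] <;> assumption
    have hs : ∀ u < 2 ^ k * 2 ^ k, τ vecA ((a * (2 ^ k * 2 ^ k) + u) * 2) =
        σ vecA ((a * (2 ^ k * 2 ^ k) + u) * 2) ∧ τ vecA ((a * (2 ^ k * 2 ^ k) + u) * 2 + 1) =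
        σ vecA ((a * (2 ^ k * 2 ^ k) + u) * 2 + 1) := by
      intro u hu
      constructor <;> refine h.other _ fun z' hz' => ?_ <;>
        have := mul_add_ne hab hu (hz'.trans hz) <;> omega
    have hd : τ vecA ((b * (2 ^ k * 2 ^ k) + z) * 2) = σ vecA ((b * (2 ^ k * 2 ^ k) + z) * 2) ∧
        τ vecA ((b * (2 ^ k * 2 ^ k) + z) * 2 + 1) =
          σ vecA ((b * (2 ^ k * 2 ^ k) + z) * 2 + 1) := by
      constructor <;> refine h.other _ fun z' hz' => ?_ <;> omega
    refine (runs_cell (B := B) (K := K) hτ hr' hab hz (fun u hu => ?_) ?_ hK hKR (hBK ▸ hBR)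
      hkR).mono le_rfl fun τ' _ _ h' => ?_
    · rw [(hs u hu).1, (hs u hu).2]
      exact ⟨hB _, hB _⟩
    · rw [hd.1, hd.2]
      exact ⟨hB _, hB _⟩
    · rw [write_of_ne (by decide)]
      have hother : ∀ i, i ≠ (b * (2 ^ k * 2 ^ k) + z) * 2 →
        i ≠ (b * (2 ^ k * 2 ^ k) + z) * 2 + 1 → τ' vecA i = τ vecA i := h'.other
      refine ⟨fun i hi => ?_, fun z' hz' => ?_, fun i => ?_⟩
      · rw [hother i (hi z (Nat.lt_succ_self z)).1 (hi z (Nat.lt_succ_self z)).2]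
        exact h.other i fun z' hz' => hi z' (by omega)
      · rcases Nat.lt_succ_iff_lt_or_eq.1 hz' with hz' | rfl
        · rw [← h.diff_eq z' hz', diff, diff, hother _ (by omega) (by omega),
            hother _ (by omega) (by omega)]
        · have e₁ : diff (τ vecA) (b * (2 ^ k * 2 ^ k) + z') =
              diff (σ vecA) (b * (2 ^ k * 2 ^ k) + z') := by rw [diff, diff, hd.1, hd.2]
          rw [h'.diff_eq, e₁]
          congr 1
          change halfStep k t (fun u => diff (τ vecA) (a * (2 ^ k * 2 ^ k) + u)) z' = _
          refine halfStep_congr (fun u hu => ?_) hz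
          rw [diff, diff, (hs u hu).1, (hs u hu).2]
      · by_cases e₁ : i = (b * (2 ^ k * 2 ^ k) + z) * 2
        · rw [e₁, hBK]; exact h'.pos_le
        by_cases e₂ : i = (b * (2 ^ k * 2 ^ k) + z) * 2 + 1
        · rw [e₂, hBK]; exact h'.neg_le
        rw [hother i e₁ e₂]
        exact h.le i

end

/-- The array `g` holds the vectors `val v` of the nodes `v < N`, and no other nodes than those
below `M` are in use. -/
structure HoldsVectors (k N M B : ℕ) (val : ℕ → ℕ → ℤ) (g : ℕ → ℕ) : Prop where
  le_nodes : N ≤ M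
  diff_eq : ∀ v < N, ∀ z < 2 ^ k * 2 ^ k, diff g (v * (2 ^ k * 2 ^ k) + z) = val v z
  zero : ∀ i, M * (2 ^ k * 2 ^ k) * 2 ≤ i → g i = 0
  le : ∀ i, g i ≤ B

lemma Stepping.diff_of_ne {k t a b B v : ℕ} {f g : ℕ → ℕ}
    (h : Stepping k t a b B f (2 ^ k * 2 ^ k) g) (hv : v ≠ b) {z : ℕ} (hz : z < 2 ^ k * 2 ^ k) :
    diff g (v * (2 ^ k * 2 ^ k) + z) = diff f (v * (2 ^ k * 2 ^ k) + z) := by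
  rw [diff, diff, h.other, h.other] <;> intro z' hz' <;> have := mul_add_ne hv hz hz' <;> omega

/-- Two half steps, by way of a fresh node. -/
lemma HoldsVectors.step {k t a b N M B B' B'' : ℕ} {val : ℕ → ℕ → ℤ} {f g h : ℕ → ℕ}
    (hf : HoldsVectors k N M B val f) (ha : a < N) (hb : b < N) (hab : a ≠ b)
    (hg : Stepping k t a M B' f (2 ^ k * 2 ^ k) g) (hh : Stepping k t M b B'' g (2 ^ k * 2 ^ k) h) :
    HoldsVectors k N (M + 1) B''
      (Function.update val b (val b + (halfStep k t * halfStep k t) (val a))) h := by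
  have hN := hf.le_nodes
  refine ⟨by omega, fun v hv z hz => ?_, fun i hi => ?_, hh.le⟩
  · by_cases e : v = b
    · subst e
      rw [Function.update_self, hh.diff_eq z hz, hg.diff_of_ne (by omega) hz, hf.diff_eq v hv z hz]
      simp only [Pi.add_apply, AddMonoid.End.coe_mul, Function.comp_apply]
      congr 1
      refine halfStep_congr (fun u hu => ?_) hz
      rw [hg.diff_eq u hu]
      -- The block of the fresh node is still zero, so adding to it amounts to assigning.
      have e₀ : diff f (M * (2 ^ k * 2 ^ k) + u) = 0 := by
        rw [diff, hf.zero _ (by omega), hf.zero _ (by omega)]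
        simp
      rw [e₀, zero_add]
      exact halfStep_congr (fun w hw => hf.diff_eq a ha w hw) hu
    · rw [Function.update_of_ne e, hh.diff_of_ne e hz, hg.diff_of_ne (by omega) hz,
        hf.diff_eq v hv z hz]
  · have e₁ : (M + 1) * (2 ^ k * 2 ^ k) = M * (2 ^ k * 2 ^ k) + 2 ^ k * 2 ^ k := by ring
    have e₂ : (b + 1) * (2 ^ k * 2 ^ k) ≤ M * (2 ^ k * 2 ^ k) :=
      Nat.mul_le_mul_right _ (by omega)
    have e₃ : (b + 1) * (2 ^ k * 2 ^ k) = b * (2 ^ k * 2 ^ k) + 2 ^ k * 2 ^ k := by ring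
    rw [hh.other i fun z hz => by omega, hg.other i fun z hz => by omega, hf.zero i (by omega)]

/-- One copy of the variable of an edge. -/
def edgeStep : Prog :=
  .let letterR (.op .add (.op .mul (.get edgeVar (reg edgeR)) (reg copiesR)) (reg copyR)) ;;
  .let fromR (.get edgeFrom (reg edgeR)) ;;
  .let toR (reg nodesR) ;;
  halfStepProg ;;
  .let fromR (reg nodesR) ;;
  .let toR (.get edgeTo (reg edgeR)) ;;
  halfStepProg ;;
  .let nodesR (.op .add (reg nodesR) (.const 1))

/-- All edges. -/
def edgeLoop : Prog := forUpTo edgeR edgesR (forUpTo copyR copiesR edgeStep)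

/-- The registers that stay fixed while the edges are passed through. -/
structure EdgeRegs (k q : ℕ) (E : List (ℕ × ℕ × ℕ)) (σ : State) : Prop where
  deg : σ degR 0 = k
  copies : σ copiesR 0 = q
  pow : σ powR 0 = 2 ^ k
  sq : σ sqR 0 = 2 ^ k * 2 ^ k
  edges : EdgesAt (σ edgeFrom) (σ edgeTo) (σ edgeVar) E

lemma EdgeRegs.congr {k q : ℕ} {E : List (ℕ × ℕ × ℕ)} {σ τ : State} (h : EdgeRegs k q E σ)
    (hf : ∀ c ∈ [degR, copiesR, powR, sqR, edgeFrom, edgeTo, edgeVar], τ c = σ c) :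
    EdgeRegs k q E τ := by
  obtain ⟨h₁, h₂, h₃, h₄, h₅⟩ := h
  refine ⟨?_, ?_, ?_, ?_, ?_⟩
  · rwa [hf _ (by decide)]
  · rwa [hf _ (by decide)]
  · rwa [hf _ (by decide)]
  · rwa [hf _ (by decide)]
  · rwa [hf edgeFrom (by decide), hf edgeTo (by decide), hf edgeVar (by decide)]

section

variable {R k q N M B K e c : ℕ} {E : List (ℕ × ℕ × ℕ)} {val : ℕ → ℕ → ℤ} {σ : State}

lemma runs_edgeStep (hσ : Bounded R σ) (hr : EdgeRegs k q E σ) (he : e < E.length)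
    (h₁ : σ edgeR 0 = e) (h₂ : σ copyR 0 = c) (hE : E[e].1 < N ∧ E[e].2.1 < N ∧ E[e].1 ≠ E[e].2.1)
    (hK : ∀ i ≤ k, (E[e].2.2 * q + c) ^ i ≤ K) (hk : 1 ≤ k) (hKR : K < 2 ^ R)
    (hBR : B * (1 + k * K) ^ 2 < 2 ^ R) (hkR : 2 ^ k < 2 ^ R) (hM : M + 1 < 2 ^ R)
    (hMσ : σ nodesR 0 = M) (h : HoldsVectors k N M B val (σ vecA)) :
    Runs R edgeStep σ (2 * (2 ^ k * 2 ^ k * (9 * k + 9) + 2) + 6) fun τ => τ nodesR 0 = M + 1 ∧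
      HoldsVectors k N (M + 1) (B * (1 + k * K) ^ 2)
        (Function.update val E[e].2.1 (val E[e].2.1 +
          (halfStep k (E[e].2.2 * q + c) * halfStep k (E[e].2.2 * q + c)) (val E[e].1)))
        (τ vecA) := by
  obtain ⟨r1, r2, r3, r4, r5⟩ := hr
  obtain ⟨e₁, e₂, e₃⟩ := r5 e he
  have hN := h.le_nodes
  have hl : E[e].2.2 * q + c ≤ K := by simpa using hK 1 hk
  set H := 2 ^ k * 2 ^ k * (9 * k + 9) + 2 with hH
  have hB₁ : B * (1 + k * K) ≤ B * (1 + k * K) ^ 2 :=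
    Nat.mul_le_mul_left _ (Nat.le_self_pow (by norm_num) _)
  have hB₂ : B * (1 + k * K) * (1 + k * K) = B * (1 + k * K) ^ 2 := by ring
  unfold edgeStep
  refine (Runs.set_seq (T := 1 + (1 + (H + (1 + (1 + (H + 1)))))) hσ ?_ fun hσ =>
    .get_seq hσ fun hσ => .get_seq hσ fun hσ =>
    .seq (runs_halfStepProg (k := k) (t := E[e].2.2 * q + c) (a := E[e].1) (b := M) (B := B)
      (K := K) hσ ?_ ?_ ?_ ?_ ?_ ?_ (by omega) ?_ hK hKR (hB₁.trans_lt hBR) hkR)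
    fun τ hτ hf hs => ?_).mono (by omega) fun _ _ _ h => h
  rotate_right
  · simp only [Expr.eval, Op.eval, write_self, write_of_ne, ne_eq, Nat.reduceEqDiff,
      not_false_eq_true] at hs
    have hf' : ∀ c ∈ [degR, letterR, edgeTo, edgeR, nodesR, powR, sqR], τ c = _ := fun c hc =>
      hf c (by intro hc'; revert hc; fin_cases hc' <;> decide)
    have f₁ := hf' degR (by decide)
    have f₂ := hf' letterR (by decide)
    have f₃ := hf' edgeTo (by decide)
    have f₄ := hf' edgeR (by decide)
    have f₅ := hf' nodesR (by decide)
    have f₆ := hf' powR (by decide)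
    have f₇ := hf' sqR (by decide)
    simp only [Expr.eval, Op.eval, write_self, write_of_ne, ne_eq, Nat.reduceEqDiff,
      not_false_eq_true, h₁, h₂, r2, e₃] at f₁ f₂ f₃ f₄ f₅ f₆ f₇
    clear hf hf'
    refine .get_seq hτ fun hτ' => .get_seq hτ' fun hτ' =>
      .seq (runs_halfStepProg (k := k) (t := E[e].2.2 * q + c) (a := M) (b := E[e].2.1)
        (B := B * (1 + k * K)) (K := K) hτ' ?_ ?_ ?_ ?_ ?_ ?_ (by omega) ?_ hK hKR (hB₂ ▸ hBR) hkR)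
      fun τ₂ hτ₂ hf₂ hs₂ => ?_
    rotate_right
    · have f₈ := hf₂ nodesR (by decide)
      simp only [Expr.eval, Op.eval, write_self, write_of_ne, ne_eq, Nat.reduceEqDiff,
        not_false_eq_true, f₅, hMσ] at f₈ hs₂
      refine .set hτ₂ ?_ ⟨?_, ?_⟩
      · simp only [Expr.eval, Op.eval, f₈, hMσ]
        exact hM
      · simp [Expr.eval, Op.eval, write_self, f₈, hMσ]
      · rw [write_of_ne (by decide), ← hB₂]
        exact h.step hE.1 hE.2.1 hE.2.2 hs hs₂
    all_goals
      simp [Expr.eval, Op.eval, write_self, write_of_ne, f₁, f₂, f₃, f₄, f₅, f₆, f₇, r1, r3, r4,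
        h₁, e₂, hMσ]
    exact hs.le
  · simp only [Expr.eval, Op.eval, h₁, h₂, r2, e₃]
    omega
  all_goals
    simp [Expr.eval, Op.eval, write_self, write_of_ne, r1, r2, r3, r4, h₁, h₂, e₁, e₃, hMσ]
  exact h.le

/-- The action of a variable that has been replaced by a sum of `q` letters. -/
noncomputable def actVar (k q i : ℕ) (y x : ℕ → ℤ) : ℕ → ℤ :=
  y + ∑ c ∈ Finset.range q, (halfStep k (i * q + c) * halfStep k (i * q + c)) x

/-- Here `S` bounds the number of letters processed. Each of them takes one fresh node and two half
steps, hence the node bound `N + S` and the entry bound `(1 + k * K) ^ (2 * S)`. -/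
lemma runs_edgeLoop {v : ℕ → ℕ → ℤ} {S : ℕ} (hσ : Bounded R σ) (hr : EdgeRegs k q E σ)
    (hE : ∀ e ∈ E, e.1 < N ∧ e.2.1 < N ∧ e.1 ≠ e.2.1)
    (hK : ∀ e ∈ E, ∀ c < q, ∀ i ≤ k, (e.2.2 * q + c) ^ i ≤ K) (hk : 1 ≤ k) (hKR : K < 2 ^ R)
    (hS : E.length * q ≤ S) (hBR : (1 + k * K) ^ (2 * S) < 2 ^ R) (hkR : 2 ^ k < 2 ^ R)
    (hM : N + S < 2 ^ R)
    (hc : σ edgesR 0 = E.length)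
    (hMσ : σ nodesR 0 = N) (h : HoldsVectors k N N 1 v (σ vecA)) :
    Runs R edgeLoop σ
      (E.length * (q * (2 * (2 ^ k * 2 ^ k * (9 * k + 9) + 2) + 8) + 4) + 2) fun τ =>
      ∃ M B, HoldsVectors k N M B (runEdges (actVar k q) E v) (τ vecA) := by
  set T := 2 * (2 ^ k * 2 ^ k * (9 * k + 9) + 2) + 6 with hT
  let I : ℕ → State → Prop := fun e τ => τ nodesR 0 = N + e * q ∧
    HoldsVectors k N (N + e * q) ((1 + k * K) ^ (2 * (e * q)))
      (runEdges (actVar k q) (E.take e) v) (τ vecA)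
  refine (Runs.forUpTo (n := E.length) (T := q * (T + 2) + 2) hσ (by decide) (by decide)
    (by decide) hc I ?_ ?_).mono ?_ ?_
  · refine ⟨by simpa [write_of_ne] using hMσ, ?_⟩
    simpa [write_of_ne, runEdges] using h
  · rintro e τ he hτ hτe hf ⟨h₁, h₂⟩
    have hr' : EdgeRegs k q E τ := hr.congr fun c hc =>
      hf c (by rintro rfl; revert hc; decide) (by intro hc'; revert hc; fin_cases hc' <;> decide)
    have hmem : E[e] ∈ E := List.getElem_mem he
    set val := runEdges (actVar k q) (E.take e) v with hval
    have hle : (e + 1) * q ≤ S := (Nat.mul_le_mul_right q he).trans hS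
    have hlast : runEdges (actVar k q) (E.take (e + 1)) v =
        Function.update val E[e].2.1 (actVar k q E[e].2.2 (val E[e].2.1) (val E[e].1)) := by
      rw [List.take_succ_eq_append_getElem he, runEdges_concat]
    let J : ℕ → State → Prop := fun c τ => τ nodesR 0 = N + e * q + c ∧
      HoldsVectors k N (N + e * q + c) ((1 + k * K) ^ (2 * (e * q + c)))
        (Function.update val E[e].2.1 (val E[e].2.1 + ∑ d ∈ Finset.range c,
          (halfStep k (E[e].2.2 * q + d) * halfStep k (E[e].2.2 * q + d)) (val E[e].1))) (τ vecA)
    refine (Runs.forUpTo (n := q) (T := T) hτ (by decide) (by decide) (by decide) hr'.copies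
      J ?_ ?_).mono le_rfl ?_
    · refine ⟨by simpa [write_of_ne] using h₁, ?_⟩
      simpa [write_of_ne] using h₂
    · rintro c τ' hc hτ' hτc hf' ⟨g₁, g₂⟩
      have hr'' : EdgeRegs k q E τ' := hr'.congr fun c hc =>
        hf' c (by rintro rfl; revert hc; decide)
          (by intro hc'; revert hc; fin_cases hc' <;> decide)
      have hτe' : τ' edgeR 0 = e := by rw [hf' edgeR (by decide) (by decide), hτe]
      have hcS : e * q + c + 1 ≤ S := by
        rw [add_mul, one_mul] at hle
        omega
      have hpow : (1 + k * K) ^ (2 * (e * q + c)) * (1 + k * K) ^ 2 =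
          (1 + k * K) ^ (2 * (e * q + (c + 1))) := by rw [← pow_add]; congr 1
      refine (runs_edgeStep hτ' hr'' he hτe' hτc (hE _ hmem) (hK _ hmem c hc) hk hKR ?_ hkR
        (by omega) g₁ g₂).mono le_rfl ?_
      · rw [hpow]
        exact (Nat.pow_le_pow_right (by omega) (by omega)).trans_lt hBR
      · rintro τ'' - - ⟨k₁, k₂⟩
        refine ⟨by simp [write_of_ne, k₁, add_assoc], ?_⟩
        -- Earlier copies have changed only the target, so each copy acts on the same source vector.
        rw [hpow, Function.update_self, Function.update_of_ne (hE _ hmem).2.2,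
          Function.update_idem] at k₂
        simpa [write_of_ne, Finset.sum_range_succ, ← add_assoc] using k₂
    · rintro τ' - - ⟨g₁, g₂⟩
      have e₁ : (e + 1) * q = e * q + q := by ring
      refine ⟨by simpa [write_of_ne, e₁, ← add_assoc] using g₁, ?_⟩
      rw [hlast, e₁, ← add_assoc, write_of_ne (by decide)]
      exact g₂
  · apply le_of_eq
    rw [hT]
  · rintro τ - - ⟨-, h'⟩
    rw [List.take_length] at h'
    exact ⟨_, _, h'⟩

end

end RAM

/-! ### The program -/

lemma List.sum_map_apply_int {α : Type} (l : List α) (F : α → ℕ → ℤ) (z : ℕ) :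
    (l.map F).sum z = (l.map fun a => F a z).sum := by
  induction l with
  | nil => rfl
  | cons a l ih => simp [ih]

/-- Squares are nonnegative and cannot cancel: the reason for working with pairs of minors. -/
lemma List.sum_map_mul_self_ne_zero_iff {α : Type} (l : List α) (F : α → ℤ) :
    (l.map fun a => F a * F a).sum ≠ 0 ↔ ∃ a ∈ l, F a ≠ 0 := by
  have h : ∀ l : List α, 0 ≤ (l.map fun a => F a * F a).sum := fun l =>
    List.sum_nonneg (by
      intro x hx
      obtain ⟨a, -, rfl⟩ := List.mem_map.1 hx
      exact mul_self_nonneg _)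
  induction l with
  | nil => simp
  | cons a l ih =>
    have h₁ := h l
    have h₂ := mul_self_nonneg (F a)
    simp only [List.map_cons, List.sum_cons, List.mem_cons, exists_eq_or_imp, ← ih]
    constructor
    · intro h₃
      by_contra! h₄
      exact h₃ (by rw [h₄.1, h₄.2]; rfl)
    · rintro (h₃ | h₃)
      · have := mul_self_pos.2 h₃
        omega
      · omega

namespace ArithFormula

variable {n : ℕ}

/-- The value that is computed for a formula is a sum of squares of Vandermonde determinants. -/
lemma flow_actVar_ne_zero_iff (C : ArithFormula n) {p k : ℕ} (hp : 2 ≤ p) (hk : 1 ≤ k) :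
    C.flow (RAM.actVar k (min (p - 1) k)) 0 0 (fun z => if z = 0 then 1 else 0)
      (2 ^ k * 2 ^ k - 1) ≠ 0 ↔ HasCMonomial p k C.toPoly := by
  have hz : 2 ^ k * 2 ^ k - 1 < 2 ^ k * 2 ^ k := by
    have : 0 < 2 ^ k * 2 ^ k := by positivity
    omega
  have hP : 0 < 2 ^ k := by positivity
  -- The last index encodes the pair of two full masks.
  have e : 2 ^ k * 2 ^ k - 1 = 2 ^ k * (2 ^ k - 1) + (2 ^ k - 1) := by
    obtain ⟨m, hm⟩ : ∃ m, 2 ^ k = m + 1 := ⟨2 ^ k - 1, by omega⟩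
    rw [hm]
    simp only [Nat.add_sub_cancel]
    ring_nf
    omega
  have e₁ : (2 ^ k * 2 ^ k - 1) / 2 ^ k = 2 ^ k - 1 := by
    rw [e, Nat.mul_add_div hP, Nat.div_eq_of_lt (by omega), add_zero]
  have e₂ : (2 ^ k * 2 ^ k - 1) % 2 ^ k = 2 ^ k - 1 := by
    rw [e, Nat.mul_add_mod, Nat.mod_eq_of_lt (by omega)]
  have := C.flow_add (fun t => halfStep k t * halfStep k t) (min (p - 1) k) 0
    (fun z => if z = 0 then (1 : ℤ) else 0)
  unfold RAM.actVar
  rw [this, zero_add, List.sum_map_apply_int]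
  simp only [prod_halfStep_apply k _ hz, e₁, e₂]
  rw [List.sum_map_mul_self_ne_zero_iff, hasCMonomial_iff C hp hk]
  simp only [minor_full_ne_zero_iff]

lemma length_encode_le (C : ArithFormula n) : C.encode.length ≤ 2 * C.size := by
  induction C with
  | var i => simp [encode, size]
  | sum m C ih =>
    simp only [encode, size, List.length_cons, List.length_flatten, List.map_ofFn, List.sum_ofFn,
      Function.comp_apply]
    have := Finset.sum_le_sum fun j (_ : j ∈ Finset.univ) => ih j
    rw [← Finset.mul_sum] at this
    omega
  | mul C D hC hD =>
    simp only [encode, size, List.length_cons, List.length_append]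
    omega

/-- A fan-in is at most the size because every operand has a node; the other tokens are variable
indices or the tags `0`, `1`, `2`. -/
lemma le_of_mem_encode (C : ArithFormula n) {x : ℕ} (hx : x ∈ C.encode) : x ≤ n + C.size + 2 := by
  induction C with
  | var i =>
    simp only [encode, List.mem_cons, List.not_mem_nil, or_false] at hx
    omega
  | sum m C ih =>
    have h₁ : m + 1 ≤ ∑ j, (C j).size := by
      simpa using Finset.card_nsmul_le_sum Finset.univ (fun j => (C j).size) 1
        fun j _ => (C j).one_le_size
    simp only [encode, size, List.mem_cons, List.mem_flatten] at hx ⊢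
    rcases hx with hx | hx | ⟨l, hl, hx⟩
    · omega
    · omega
    · obtain ⟨j, rfl⟩ := (List.mem_ofFn' _ _).1 hl
      have h₂ := ih j hx
      have h₃ := Finset.single_le_sum (f := fun j => (C j).size) (fun _ _ => Nat.zero_le _)
        (Finset.mem_univ j)
      omega
  | mul C D hC hD =>
    simp only [encode, size, List.mem_cons, List.mem_append] at hx ⊢
    rcases hx with hx | hx | hx
    · omega
    · have := hC hx; omega
    · have := hD hx; omega

end ArithFormula

namespace RAM

/-- Twice the number of the integer that decides. -/
def answerE : Expr :=
  .op .mul (.op .add (reg sqR) (.op .sub (reg sqR) (.const 1))) (.const 2)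

/-- Decides whether the formula on the input has a monomial of top degree with exponents smaller
than the prime on the input. -/
def monomialTest : Prog :=
  parse ;;
  .let degR (.get degA (.const 1)) ;;
  -- `(p - 1) - ((p - 1) - k)` is `min (p - 1) k`.
  .let copiesR (.op .sub (.op .sub (.get 0 (.const 1)) (.const 1))
    (.op .sub (.op .sub (.get 0 (.const 1)) (.const 1)) (reg degR))) ;;
  .let powR (.const 1) ;;
  forUpTo cntR degR (.let powR (.op .mul (reg powR) (.const 2))) ;;
  .let sqR (.op .mul (reg powR) (reg powR)) ;;
  -- The vector of node `0` becomes that of the empty word: `1` at the pair of empty masks.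
  .set vecA (.const 0) (.const 1) ;;
  edgeLoop ;;
  -- The two truncated differences add up to the absolute value of the integer.
  .let 1 (.op .add (.op .sub (.get vecA answerE) (.get vecA (.op .add answerE (.const 1))))
    (.op .sub (.get vecA (.op .add answerE (.const 1))) (.get vecA answerE)))

lemma holdsVectors_start {k N : ℕ} {g : ℕ → ℕ} (hN : 0 < N) (hg : ∀ i, g i = 0) :
    HoldsVectors k N N 1 (Function.update (fun _ => 0) 0 fun z => if z = 0 then 1 else 0)
      (Function.update g 0 1) := by
  have hP : 0 < 2 ^ k * 2 ^ k := by positivity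
  refine ⟨le_rfl, fun v _ z hz => ?_, fun i hi => ?_, fun i => ?_⟩
  · by_cases hv : v = 0
    · subst hv
      by_cases h0 : z = 0 <;> simp [diff, hg, h0]
    · have : v * (2 ^ k * 2 ^ k) ≠ 0 := by positivity
      simp only [Function.update_of_ne hv, diff]
      rw [Function.update_of_ne (by omega), Function.update_of_ne (by omega), hg, hg]
      simp
  · have : 0 < N * (2 ^ k * 2 ^ k) := by positivity
    rw [Function.update_of_ne (by omega), hg]
  · by_cases h0 : i = 0 <;> simp [h0, hg]

/-- The assumptions on `R` make room, in order, for the parser, powers of letters, entries of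
vectors, indices of pairs, and node numbers. -/
lemma runs_monomialTest {n p R : ℕ} (C : ArithFormula n) (hp : 2 ≤ p)
    (hσ : Bounded R (init (p :: n :: C.encode)))
    (h₁ : 2 * C.size + 3 < 2 ^ R) (h₂ : (n * C.deg) ^ C.deg < 2 ^ R)
    (h₃ : (1 + C.deg * (n * C.deg) ^ C.deg) ^ (2 * (C.size * C.deg)) < 2 ^ R)
    (h₄ : 2 ^ C.deg * 2 ^ C.deg < 2 ^ R) (h₅ : C.size + 2 + C.size * C.deg < 2 ^ R) :
    Runs R monomialTest (init (p :: n :: C.encode))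
      (C.size * (5 * C.size + 21) + 3 * C.deg + C.size *
        (C.deg * (2 * (2 ^ C.deg * 2 ^ C.deg * (9 * C.deg + 9) + 2) + 8) + 4) + 20) fun τ =>
      (Accepts τ ↔ HasCMonomial p C.deg C.toPoly) := by
  set k := C.deg with hk
  have hk1 : 1 ≤ k := C.one_le_deg
  have hkP : 0 < 2 ^ k := by positivity
  have hkP2 : 2 ^ k ≤ 2 ^ k * 2 ^ k := Nat.le_mul_of_pos_left _ hkP
  have hpR : p < 2 ^ R := by simpa [init] using hσ.2 0 1
  set T := C.size * (k * (2 * (2 ^ k * 2 ^ k * (9 * k + 9) + 2) + 8) + 4) + 2 with hT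
  unfold monomialTest
  refine (Runs.seq (runs_parse hσ h₁) (T' := 1 + (1 + (1 + ((k * (1 + 2) + 2) + (1 + (1 + (T + 1)))))))
    ?_).mono (by omega) fun _ _ _ h => h
  rintro σ hσ hf ⟨E, hE⟩
  have i₁ : σ 0 1 = p := by rw [hf 0 (by decide)]; simp [init]
  have i₂ : ∀ i, σ vecA i = 0 := fun i => by rw [hf vecA (by decide)]; simp [init]
  clear hf
  have hdeg : σ degA 1 = k := by
    rw [hE.degree]
    have := hE.graph.flow_eq ℕ (fun _ y x => max y (x + 1)) 0 (fun _ => 0) fun _ _ => rfl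
    rw [C.flow_deg] at this
    simpa [runTodo] using this
  have hflow := hE.graph.flow_eq (ℕ → ℤ) (actVar k (min (p - 1) k)) 0
    (Function.update (fun _ => 0) 0 fun z => if z = 0 then 1 else 0) fun u hu => by
      rw [Function.update_of_ne (by omega)]
  simp only [runTodo, List.foldl_nil, Function.update_self, Function.update_of_ne one_ne_zero]
    at hflow
  have hlen := hE.graph.edges_le
  have hnodes := hE.graph.nodes_le
  have htwo := hE.graph.two_le
  have hEdge := hE.graph.edge_lt
  have hcount := hE.count
  have hedges := hE.edges
  set q := min (p - 1) k with hq
  have hqk : q ≤ k := min_le_right _ _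
  clear hE
  refine .get_seq hσ fun hσ => .set_seq hσ ?_ fun hσ => .set_seq hσ ?_ fun hσ =>
    .seq (Runs.forUpTo (n := k) (T := 1) hσ (by decide) (by decide) (by decide) ?_
      (fun i τ => τ powR 0 = 2 ^ i) ?_ ?_) fun τ hτ hf hτp => ?_
  · simp [Expr.eval, Op.eval, write_self, write_of_ne, i₁]
    omega
  · simp only [Expr.eval]
    omega
  · simp [Expr.eval, write_self, write_of_ne, hdeg]
  · simp [Expr.eval, write_self, write_of_ne]
  · intro i τ hi hτ _ _ h
    have : 2 ^ i * 2 ≤ 2 ^ k := by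
      rw [← pow_succ]
      exact Nat.pow_le_pow_right (by norm_num) hi
    refine .set hτ ?_ ?_
    · simp only [Expr.eval, Op.eval, h]
      omega
    · simp [Expr.eval, Op.eval, write_self, write_of_ne, h, pow_succ]
  have hf' : ∀ c, c ∉ [cntR, powR] → τ c = _ := fun c hc => hf c (by
    simp [forUpTo, Prog.targets] at hc ⊢
    omega)
  have f₁ : τ degR 0 = k := by
    rw [hf' _ (by decide)]
    simp [Expr.eval, write_self, write_of_ne, hdeg]
  have f₂ : τ copiesR 0 = q := by
    rw [hf' _ (by decide)]
    simp [Expr.eval, Op.eval, write_self, write_of_ne, hdeg, i₁]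
    omega
  have f₃ : ∀ i, τ vecA i = 0 := by
    intro i
    rw [hf' _ (by decide)]
    simp [write_of_ne, i₂]
  have f₄ : ∀ c ∈ [nodesR, edgesR, edgeFrom, edgeTo, edgeVar], τ c = σ c := by
    intro c hc
    rw [hf' c (by intro hc'; revert hc; fin_cases hc' <;> decide)]
    fin_cases hc <;> simp [write_of_ne]
  clear hf hf'
  refine .set_seq hτ ?_ fun hτ => .set_seq hτ ?_ fun hτ =>
    .seq ((runs_edgeLoop (k := k) (q := q) (E := E) (N := σ nodesR 0) (K := (n * k) ^ k)
      (S := C.size * k) (v := Function.update (fun _ => 0) 0 fun z => if z = 0 then 1 else 0) hτ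
      ⟨?_, ?_, ?_, ?_, ?_⟩ (fun e he => ?_) (fun e he c hc i hi => ?_) hk1 h₂
      (Nat.mul_le_mul (by omega) hqk) h₃ (by omega) (by omega) ?_ ?_ ?_).mono ?_
      fun _ _ _ h => h) fun τ' hτ' hf' hV => ?_
  · simpa only [Expr.eval, Op.eval, hτp] using h₄
  · simp only [Expr.eval]
    omega
  · simp [write_of_ne, f₁]
  · simp [write_of_ne, f₂]
  · simp [write_of_ne, hτp]
  · simp [Expr.eval, Op.eval, write_self, write_of_ne, hτp]
  · simpa [write_of_ne, f₄] using hedges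
  · exact ⟨(hEdge e he).1, (hEdge e he).2.1, (hEdge e he).2.2.1⟩
  · have hl := (hEdge e he).2.2.2
    have hb : e.2.2 * q + c ≤ n * k :=
      calc e.2.2 * q + c ≤ (e.2.2 + 1) * q := by rw [add_mul]; omega
        _ ≤ n * k := Nat.mul_le_mul hl hqk
    have hnk : 0 < n * k := Nat.mul_pos (by omega) hk1
    exact (Nat.pow_le_pow_left hb i).trans (Nat.pow_le_pow_right hnk hi)
  · simp [write_of_ne, f₄, hcount]
  · simp [write_of_ne, f₄]
  · rw [write_self, write_of_ne (by decide)]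
    exact holdsVectors_start (by omega) f₃
  · rw [hT]
    gcongr
    omega
  · obtain ⟨M, B, hV⟩ := hV
    have hsq : τ' sqR 0 = 2 ^ k * 2 ^ k := by
      rw [hf' _ (by decide)]
      simp [Expr.eval, Op.eval, write_self, write_of_ne, hτp]
    have hval := hV.diff_eq 1 (by omega) (2 ^ k * 2 ^ k - 1) (by omega)
    rw [hflow, one_mul] at hval
    have key := C.flow_actVar_ne_zero_iff (k := k) hp hk1
    rw [← hq] at key
    rw [← hval, diff] at key
    have u₁ := hτ'.2 vecA ((2 ^ k * 2 ^ k + (2 ^ k * 2 ^ k - 1)) * 2)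
    have u₂ := hτ'.2 vecA ((2 ^ k * 2 ^ k + (2 ^ k * 2 ^ k - 1)) * 2 + 1)
    refine .set hτ' ?_ ?_
    · simp only [Expr.eval, Op.eval, answerE, hsq]
      omega
    · rw [← key, Accepts]
      simp only [Expr.eval, Op.eval, answerE, hsq, write_self, Function.update_self]
      omega

lemma bounded_init {n p R : ℕ} (C : ArithFormula n) (hR : 1 ≤ R) (hp : p ≤ R)
    (h : n + 2 * C.size + 2 ≤ R) : Bounded R (init (p :: n :: C.encode)) := by
  refine ⟨hR, fun a i => lt_of_le_of_lt ?_ (Nat.lt_two_pow_self (n := R))⟩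
  have hl := C.length_encode_le
  match a, i with
  | 0, 0 =>
    simp only [init, List.length_cons]
    omega
  | 0, i + 1 =>
    simp only [init, List.getD_eq_getElem?_getD]
    rcases lt_or_ge i (p :: n :: C.encode).length with hi | hi
    · rw [List.getElem?_eq_getElem hi, Option.getD_some]
      have hm := List.getElem_mem hi
      simp only [List.mem_cons] at hm
      rcases hm with hm | hm | hm
      · omega
      · omega
      · have := C.le_of_mem_encode hm
        have := C.one_le_size
        omega
    · rw [List.getElem?_eq_none hi]
      simp
  | a + 1, i => simp [init]

end RAM

/-! ### The running time -/

lemma four_pow_mul_le {p k : ℕ} (hk : 1 ≤ k) :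
    (4 : ℝ) ^ k * p ≤ 4 * ((6.4 : ℝ) ^ k + (p : ℝ) ^ k) := by
  have h₁ : (4 : ℝ) ^ k ≤ 6.4 ^ k := pow_le_pow_left₀ (by norm_num) (by norm_num) k
  have hp0 : (0 : ℝ) ≤ p := Nat.cast_nonneg p
  have h₂ : 0 ≤ (p : ℝ) ^ k := by positivity
  -- For `p ≤ 4` the factor `p` is a constant; otherwise `4 ^ k * p = 4 * (4 ^ (k - 1) * p) ≤ 4 * p
  -- ^ k`.
  rcases le_total (p : ℝ) 4 with hp | hp
  · nlinarith [pow_nonneg (show (0 : ℝ) ≤ 4 by norm_num) k]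
  · obtain ⟨j, rfl⟩ : ∃ j, k = j + 1 := ⟨k - 1, by omega⟩
    have h₃ : (4 : ℝ) ^ j ≤ (p : ℝ) ^ j := pow_le_pow_left₀ (by norm_num) hp j
    have h₄ : (4 : ℝ) ^ j * p ≤ (p : ℝ) ^ j * p := mul_le_mul_of_nonneg_right h₃ hp0
    have h₅ : (0 : ℝ) ≤ 6.4 ^ (j + 1) := by positivity
    rw [pow_succ, pow_succ (p : ℝ)]
    nlinarith

/-- Here `W` is the weight of the program. There are at most `120 * 4 ^ k * m ^ 3` steps and the
word length is at most `8 * p * m ^ 4`; this gives the exponent `7`, and `120 * 8 * 4 = 3840` is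
covered by `4000`. -/
lemma running_time_le {p n k S W t : ℕ} (hp1 : 1 ≤ p) (hk : 1 ≤ k) (hkS : k ≤ S)
    (h₂ : t ≤ (S * (5 * S + 21) + 3 * k + S *
      (k * (2 * (2 ^ k * 2 ^ k * (9 * k + 9) + 2) + 8) + 4) + 20) *
        (W * (p + 6 * (n + k + S) ^ 4 + 1))) :
    (t : ℝ) ≤ (4000 * W + 7 : ℕ) * ((6.4 : ℝ) ^ k + (p : ℝ) ^ k) *
      ((n : ℝ) + k + S) ^ (4000 * W + 7) := by
  set m := n + k + S with hm
  have hm1 : 1 ≤ m := by omega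
  set R := p + 6 * m ^ 4 + 1 with hR
  have hPP : 2 ^ k * 2 ^ k = 4 ^ k := by rw [← mul_pow]; norm_num
  rw [hPP] at h₂
  have hQ : 1 ≤ 4 ^ k := Nat.one_le_pow _ _ (by norm_num)
  have hsteps : S * (5 * S + 21) + 3 * k + S *
      (k * (2 * (4 ^ k * (9 * k + 9) + 2) + 8) + 4) + 20 ≤ 120 * (4 ^ k * m ^ 3) := by
    have hm3 : m ≤ m ^ 3 := Nat.le_self_pow (by norm_num) m
    have hm23 : m ^ 2 ≤ m ^ 3 := Nat.pow_le_pow_right hm1 (by norm_num)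
    calc _ ≤ m * (5 * m + 21) + 3 * m + m * (m * (2 * (4 ^ k * (9 * m + 9) + 2) + 8) + 4) + 20 := by
          have a₁ : S ≤ m := by omega
          have a₂ : k ≤ m := by omega
          generalize 4 ^ k = Q
          gcongr
      _ = 18 * (4 ^ k * m ^ 3) + 18 * (4 ^ k * m ^ 2) + 17 * m ^ 2 + 28 * m + 20 := by ring
      _ ≤ 18 * (4 ^ k * m ^ 3) + 18 * (4 ^ k * m ^ 3) + 65 * (1 * m ^ 3) := by
          have := Nat.mul_le_mul_left (4 ^ k) hm23
          omega
      _ ≤ 120 * (4 ^ k * m ^ 3) := by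
          have := Nat.mul_le_mul_right (m ^ 3) hQ
          omega
  have hRm : R ≤ 8 * (p * m ^ 4) := by
    have hm41 : 1 ≤ m ^ 4 := Nat.one_le_pow _ _ hm1
    have := Nat.mul_le_mul_left p hm41
    have := Nat.mul_le_mul_right (m ^ 4) hp1
    omega
  have hnat : t ≤ 960 * W * (4 ^ k * p) * m ^ 7 :=
    calc t ≤ 120 * (4 ^ k * m ^ 3) * (W * (8 * (p * m ^ 4))) :=
          h₂.trans (Nat.mul_le_mul hsteps (Nat.mul_le_mul_left W hRm))
      _ = _ := by ring
  have hreal : (t : ℝ) ≤ 960 * W * ((4 : ℝ) ^ k * p) * (m : ℝ) ^ 7 := by exact_mod_cast hnat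
  have hmr : ((n : ℝ) + k + S) = (m : ℝ) := by rw [hm]; push_cast; ring
  have hm1r : (1 : ℝ) ≤ m := by exact_mod_cast hm1
  rw [hmr]
  refine hreal.trans (mul_le_mul ?_ (pow_le_pow_right₀ hm1r (by omega)) (by positivity)
    (by positivity))
  have h0 : (0 : ℝ) ≤ (6.4 : ℝ) ^ k + (p : ℝ) ^ k := by positivity
  calc 960 * (W : ℝ) * ((4 : ℝ) ^ k * p)
      ≤ 960 * W * (4 * ((6.4 : ℝ) ^ k + (p : ℝ) ^ k)) :=
        mul_le_mul_of_nonneg_left (four_pow_mul_le hk) (by positivity)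
    _ = 3840 * W * ((6.4 : ℝ) ^ k + (p : ℝ) ^ k) := by ring
    _ ≤ _ := by
        refine mul_le_mul_of_nonneg_right ?_ h0
        push_cast
        have : (0 : ℝ) ≤ W := Nat.cast_nonneg W
        linarith

theorem theorem2 :
    ∃ (P : RAM.Prog) (c : ℕ), ∀ (p : ℕ), p.Prime → ∀ (n k : ℕ) (C : ArithFormula n),
      C.toPoly.totalDegree = k →
        ∃ (t : ℕ) (σ : RAM.State),
          RAM.Exec P (RAM.init (p :: n :: C.encode)) t σ ∧
          (RAM.Accepts σ ↔ HasCMonomial p k C.toPoly) ∧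
          (t : ℝ) ≤ c * ((6.4 : ℝ) ^ k + (p : ℝ) ^ k) * ((n : ℝ) + k + C.size) ^ c := by
  refine ⟨RAM.monomialTest, 4000 * RAM.monomialTest.weight + 7, fun p hp n k C hk => ?_⟩
  rw [C.totalDegree_toPoly] at hk
  subst hk
  set k := C.deg with hk
  set m := n + k + C.size with hm
  have hk1 : 1 ≤ k := C.one_le_deg
  have hkS : k ≤ C.size := C.deg_le_size
  have hm1 : 1 ≤ m := by omega
  have hm2 : m ≤ m ^ 2 := Nat.le_self_pow (by norm_num) m
  have hm4 : m ^ 2 ≤ m ^ 4 := Nat.pow_le_pow_right hm1 (by norm_num)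
  -- The entries of the vectors are at most `(2 ^ (3 * m ^ 2)) ^ (2 * m ^ 2)`, whence `6 * m ^ 4`.
  -- The summand `p` leaves room for the prime on the input, and `1` makes the bounds strict.
  set R := p + 6 * m ^ 4 + 1 with hR
  have hRR : ∀ x, x ≤ R → x < 2 ^ R := fun x hx => hx.trans_lt Nat.lt_two_pow_self
  have hlt : m < 2 ^ m := Nat.lt_two_pow_self
  have hnk : n * k ≤ 2 ^ (2 * m) :=
    calc n * k ≤ 2 ^ m * 2 ^ m := Nat.mul_le_mul (by omega) (by omega)
      _ = 2 ^ (2 * m) := by rw [← pow_add, two_mul]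
  have hK : (n * k) ^ k ≤ 2 ^ (2 * m ^ 2) :=
    calc (n * k) ^ k ≤ (2 ^ (2 * m)) ^ k := Nat.pow_le_pow_left hnk k
      _ = 2 ^ (2 * m * k) := by rw [← pow_mul]
      _ ≤ 2 ^ (2 * m ^ 2) := Nat.pow_le_pow_right (by norm_num) (by nlinarith)
  have hG : 1 + k * (n * k) ^ k ≤ 2 ^ (3 * m ^ 2) :=
    calc 1 + k * (n * k) ^ k ≤ 1 * 2 ^ (2 * m ^ 2) + k * 2 ^ (2 * m ^ 2) := by
          have := Nat.one_le_two_pow (n := 2 * m ^ 2)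
          gcongr
          omega
      _ = (1 + k) * 2 ^ (2 * m ^ 2) := by ring
      _ ≤ 2 ^ (m ^ 2) * 2 ^ (2 * m ^ 2) := by
          have : 2 ^ m ≤ 2 ^ (m ^ 2) := Nat.pow_le_pow_right (by norm_num) hm2
          gcongr
          omega
      _ = 2 ^ (3 * m ^ 2) := by rw [← pow_add]; congr 1; ring
  have hSk : C.size * k ≤ m ^ 2 := by
    rw [pow_two]
    exact Nat.mul_le_mul (by omega) (by omega)
  obtain ⟨t, σ, h₁, h₂, -, h₃⟩ := RAM.runs_monomialTest (R := R) C hp.two_le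
    (RAM.bounded_init C (by omega) (by omega) (by omega))
    (hRR _ (by omega)) (hK.trans_lt (Nat.pow_lt_pow_right (by norm_num) (by omega)))
    (calc (1 + k * (n * k) ^ k) ^ (2 * (C.size * k))
          ≤ (2 ^ (3 * m ^ 2)) ^ (2 * (C.size * k)) := Nat.pow_le_pow_left hG _
        _ = 2 ^ (3 * m ^ 2 * (2 * (C.size * k))) := by rw [← pow_mul]
        _ < 2 ^ R := Nat.pow_lt_pow_right (by norm_num) (by
          have := Nat.mul_le_mul_left (6 * m ^ 2) hSk
          have e : 6 * m ^ 2 * m ^ 2 = 6 * m ^ 4 := by ring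
          have e' : 3 * m ^ 2 * (2 * (C.size * k)) = 6 * m ^ 2 * (C.size * k) := by ring
          omega))
    (by rw [← pow_add]; exact Nat.pow_lt_pow_right (by norm_num) (by omega))
    (hRR _ (by rw [← hk]; omega))
  exact ⟨t, σ, h₁, h₃, running_time_le hp.one_lt.le hk1 hkS h₂⟩
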